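/- Let $\varphi_0(z)=e^z$ and $\varphi_k(z)=\int_0^1 e^{(1-\theta)z}\frac{\theta^{k-1}}{(k-1)!}\,d\theta$ for $k\ge 1$. For a problem $u'=F(u)=Au+g(u)$, $u(t_0)=u_0$, an $s$-stage explicit exponential Runge--Kutta method with step size $h>0$ is $$U_{ni}=u_n+c_ih\varphi_1(c_ihA)F(u_n)+h\sum_{j=2}^{i-1}a_{ij}(hA)\bigl(g(U_{nj})-g(u_n)\bigr),\qquad 2\le i\le s,$$ $$u_{n+1}=u_n+h\varphi_1(hA)F(u_n)+h\sum_{i=2}^{s}b_i(hA)\bigl(g(U_{ni})-g(u_n)\bigr),$$ with nodes $c_i\ge 0$ and coefficients $a_{ij}(z),b_i(z)$ that are finite linear combinations of functions $\varphi_k(rz)$, $k\ge 0$, $r\ge 0$. (The expression $v+\tau\varphi_1(\tau A)F(v)$ is read as $e^{\tau A}v+\tau\varphi_1(\tau A)g(v)$, which is the same for $v$ in the domain of $A$.) The method is *of order 5* if it is convergent of order 5 for semilinear parabolic problems: for every complex Banach space $X$, every generator $A$ of an analytic semigroup on $X$, and every $g:X\to X$ and smooth solution $u:[t_0,T]\to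 X$ of $u'=Au+g(u)$ such that $g$ is infinitely often Fréchet differentiable with uniformly bounded derivatives in a strip along $u$, there are constants $C$ and $h_0>0$ such that $\|u_n-u(t_0+nh)\|\le Ch^5$ for all $0<h\le h_0$ and all $n\ge 0$ with $t_0+nh\le T$, where $u_0=u(t_0)$. The *stiff order conditions up to order four* are, with $\psi_{j,i}(Z)=\sum_{k=2}^{i-1}a_{ik}(Z)\frac{c_k^{j-1}}{(j-1)!}-c_i^j\varphi_j(c_iZ)$ and for all square complex matrices $Z,J,K$ of the same size: 1. $\sum_{i=2}^s b_i(Z)c_i=\varphi_2(Z)$; 2. $\sum_{i=2}^s b_i(Z)\frac{c_i^2}{2!}=\varphi_3(Z)$; 3. $\sum_{i=2}^s b_i(Z)J\psi_{2,i}(Z)=0$; 4. $\sum_{i=2}^s b_i(Z)\frac{c_i^3}{3!}=\varphi_4(Z)$; 5. $\sum_{i=2}^s b_i(Z)J\psi_{3,i}(Z)=0$; 6. $\sum_{i=2}^s b_i(Z)J\sum_{j=2}^{i-1}a_{ij}(Z)J\psi_{2,j}(Z)=0$; 7. $\sum_{i=2}^s b_i(Z)c_iK\psi_{2,i}(Z)=0$.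 **Theorem.** Let $s\le 6$. There is no explicit exponential Runge--Kutta method of order 5 with $s$ stages. Moreover, no explicit exponential Runge--Kutta method with $s$ stages satisfies all the stiff order conditions 1--7. -/

import Mathlib

open scoped ContDiff Topology NNReal

noncomputable section

namespace ExpRK

/-! ### Coefficient functions -/

/-- A coefficient function: a finite linear combination, with complex weights, of scaled functions
`z ↦ φ_k (r z)`, `k ∈ ℕ`, `r ≥ 0`. The weight of `z ↦ φ_k (r z)` is the value at `(k, r)`. -/
abbrev Coeff : Type := (ℕ × ℝ≥0) →₀ ℂ

/-- `φ_k` of a square matrix: `φ_0 (Z) = exp Z` and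
`φ_k (Z) = ∫₀¹ exp ((1 - θ) Z) θ^(k-1) / (k-1)! dθ` for `k ≥ 1` (entrywise integral). -/
def phiMatrix {d : ℕ} (k : ℕ) (Z : Matrix (Fin d) (Fin d) ℂ) : Matrix (Fin d) (Fin d) ℂ :=
  if k = 0 then NormedSpace.exp Z
  else Matrix.of fun p q =>
    ∫ θ in (0 : ℝ)..1,
      NormedSpace.exp (((1 - θ : ℝ) : ℂ) • Z) p q * ((θ ^ (k - 1) / (k - 1).factorial : ℝ) : ℂ)

/-- The value of a coefficient function at a square matrix. -/
def Coeff.atMatrix {d : ℕ} (f : Coeff) (Z : Matrix (Fin d) (Fin d) ℂ) :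
    Matrix (Fin d) (Fin d) ℂ :=
  f.sum fun p α => α • phiMatrix p.1 (((p.2 : ℝ) : ℂ) • Z)

section Semigroup

variable {X : Type*} [NormedAddCommGroup X] [NormedSpace ℂ X]

/-- `φ_k (t A) x` for the generator `A` of the semigroup `S t = exp (t A)`. -/
def phiSemigroup (S : ℝ → X →L[ℂ] X) (k : ℕ) (t : ℝ) (x : X) : X :=
  if k = 0 then S t x
  else ∫ θ in (0 : ℝ)..1, (θ ^ (k - 1) / (k - 1).factorial : ℝ) • S ((1 - θ) * t) x

/-- `f (h A) x` for a coefficient function `f` and the generator `A` of the semigroup `S`. -/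
def Coeff.atSemigroup (f : Coeff) (S : ℝ → X →L[ℂ] X) (h : ℝ) (x : X) : X :=
  f.sum fun p α => α • phiSemigroup S p.1 (p.2 * h) x

end Semigroup

/-! ### Methods and stiff order conditions -/

/-- The data of an explicit exponential Runge–Kutta method: nodes `c i`, and
coefficient functions `a i j`, `b i`. An `s`-stage method uses only
`c i`, `b i` for `2 ≤ i ≤ s` and `a i j` for `2 ≤ j < i ≤ s`. The coefficients belonging to the
first stage (`c 1 = 0`, `U 1 = u`) are eliminated. -/
structure Method where
  c : ℕ → ℝ≥0
  a : ℕ → ℕ → Coeff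
  b : ℕ → Coeff

namespace Method

/-- The node as a complex number. -/
def node (m : Method) (i : ℕ) : ℂ := ((m.c i : ℝ) : ℂ)

/-- `ψ_{j,i} (Z) = ∑_{k=2}^{i-1} a_{ik} (Z) c_k^{j-1} / (j-1)! - c_i^j φ_j (c_i Z)`. -/
def psi (m : Method) {d : ℕ} (j i : ℕ) (Z : Matrix (Fin d) (Fin d) ℂ) :
    Matrix (Fin d) (Fin d) ℂ :=
  (∑ k ∈ Finset.Ico 2 i, (m.node k ^ (j - 1) / ((j - 1).factorial : ℂ)) • (m.a i k).atMatrix Z)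
    - m.node i ^ j • phiMatrix j (m.node i • Z)

/-- The stiff order conditions up to order four of the `s`-stage method `m`, for
arbitrary square matrices `Z`, `J`, `K` of the same arbitrary size. -/
structure StiffOrderFour (m : Method) (s : ℕ) : Prop where
  cond1 : ∀ (d : ℕ) (Z : Matrix (Fin d) (Fin d) ℂ),
    ∑ i ∈ Finset.Icc 2 s, m.node i • (m.b i).atMatrix Z = phiMatrix 2 Z
  cond2 : ∀ (d : ℕ) (Z : Matrix (Fin d) (Fin d) ℂ),
    ∑ i ∈ Finset.Icc 2 s, (m.node i ^ 2 / 2) • (m.b i).atMatrix Z = phiMatrix 3 Z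
  cond3 : ∀ (d : ℕ) (Z J : Matrix (Fin d) (Fin d) ℂ),
    ∑ i ∈ Finset.Icc 2 s, (m.b i).atMatrix Z * J * m.psi 2 i Z = 0
  cond4 : ∀ (d : ℕ) (Z : Matrix (Fin d) (Fin d) ℂ),
    ∑ i ∈ Finset.Icc 2 s, (m.node i ^ 3 / 6) • (m.b i).atMatrix Z = phiMatrix 4 Z
  cond5 : ∀ (d : ℕ) (Z J : Matrix (Fin d) (Fin d) ℂ),
    ∑ i ∈ Finset.Icc 2 s, (m.b i).atMatrix Z * J * m.psi 3 i Z = 0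
  cond6 : ∀ (d : ℕ) (Z J : Matrix (Fin d) (Fin d) ℂ),
    ∑ i ∈ Finset.Icc 2 s, (m.b i).atMatrix Z * J *
      (∑ j ∈ Finset.Ico 2 i, (m.a i j).atMatrix Z * J * m.psi 2 j Z) = 0
  cond7 : ∀ (d : ℕ) (Z K : Matrix (Fin d) (Fin d) ℂ),
    ∑ i ∈ Finset.Icc 2 s, m.node i • ((m.b i).atMatrix Z * K * m.psi 2 i Z) = 0

end Method

/-! ### Semilinear parabolic problems -/

/-- The open sector of half-angle `δ` around the positive real axis. -/
def sector (δ : ℝ) : Set ℂ := {z | z ≠ 0 ∧ |z.arg| < δ}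

section Problem

variable {X : Type*} [NormedAddCommGroup X] [NormedSpace ℂ X]

/-- `S` (on `t ≥ 0`) is an analytic semigroup: it extends to a holomorphic, strongly
continuous semigroup on some sector around the positive real axis. -/
def IsAnalyticSemigroup (S : ℝ → X →L[ℂ] X) : Prop :=
  ∃ δ : ℝ, 0 < δ ∧ δ ≤ Real.pi / 2 ∧ ∃ E : ℂ → X →L[ℂ] X,
    (∀ t : ℝ, 0 ≤ t → E t = S t) ∧
    E 0 = 1 ∧
    (∀ z ∈ sector δ, ∀ w ∈ sector δ, E (z + w) = (E z).comp (E w)) ∧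
    DifferentiableOn ℂ E (sector δ) ∧
    ∀ x : X, Filter.Tendsto (fun z => E z x) (𝓝[sector δ] 0) (𝓝 x)

/-- `A` is the infinitesimal generator of `S`: its domain consists of exactly those `x` for which
`(S t x - x) / t` converges as `t ↓ 0`, and `A x` is the limit. -/
def IsGenerator (A : X →ₗ.[ℂ] X) (S : ℝ → X →L[ℂ] X) : Prop :=
  ∀ x y : X, (x, y) ∈ A.graph ↔
    Filter.Tendsto (fun t : ℝ => t⁻¹ • (S t x - x)) (𝓝[>] 0) (𝓝 y)

end Problem

/-- An initial value problem `u' = A u + g (u)`, `u (t₀) = u₀`, on `[t₀, T]` in the space `X`,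
together with its exact solution `u`, such that `A` generates an analytic semigroup, the solution
is smooth with values in `X`, and `g` is Fréchet smooth with uniformly
bounded derivatives in a strip along the exact solution. -/
structure ParabolicProblem (X : Type*) [NormedAddCommGroup X] [NormedSpace ℂ X] where
  /-- the linear operator, possibly unbounded -/
  A : X →ₗ.[ℂ] X
  /-- the semigroup `S t = exp (t A)` -/
  S : ℝ → X →L[ℂ] X
  /-- the nonlinearity -/
  g : X → X
  t₀ : ℝ
  T : ℝ
  /-- the exact solution -/
  u : ℝ → X
  lt : t₀ < T
  analytic : IsAnalyticSemigroup S
  generator : IsGenerator A S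
  smooth_u : ContDiffOn ℝ ∞ u (Set.Icc t₀ T)
  /-- `u t` lies in the domain of `A` and `u' t = A (u t) + g (u t)` -/
  solution : ∀ t ∈ Set.Icc t₀ T, (u t, derivWithin u (Set.Icc t₀ T) t - g (u t)) ∈ A.graph
  smooth_g : ∃ r : ℝ, 0 < r ∧
    ContDiffOn ℂ ∞ g (Metric.thickening r (u '' Set.Icc t₀ T)) ∧
    ∀ k : ℕ, ∃ B : ℝ, ∀ x ∈ Metric.thickening r (u '' Set.Icc t₀ T),
      ‖iteratedFDeriv ℂ k g x‖ ≤ B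

/-! ### The numerical scheme and its convergence -/

namespace Method

section Scheme

variable {X : Type*} [NormedAddCommGroup X] [NormedSpace ℂ X]

/-- The term `v + τ φ_1 (τ A) (A v + g (v))`. Since `τ φ_1 (τ A) A v = exp (τ A) v - v`, it equals
`exp (τ A) v + τ φ_1 (τ A) g (v)`, which is meaningful for every `v` in `X`. -/
def exponentialEuler (P : ParabolicProblem X) (τ : ℝ) (v : X) : X :=
  P.S τ v + τ • phiSemigroup P.S 1 τ (P.g v)

/-- The internal stages
`U_i = v + c_i h φ_1 (c_i h A) F (v) + h ∑_{j=2}^{i-1} a_{ij} (h A) (g (U_j) - g (v))`. -/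
def stage (m : Method) (P : ParabolicProblem X) (h : ℝ) (v : X) (i : ℕ) : X :=
  exponentialEuler P (m.c i * h) v +
    h • ∑ j : Finset.Ico 2 i,
      (m.a i j).atSemigroup P.S h (P.g (stage m P h v j.1) - P.g v)
termination_by i
decreasing_by exact (Finset.mem_Ico.mp j.2).2

/-- One step of the `s`-stage method, of size `h`, from `v`:
`v + h φ_1 (h A) F (v) + h ∑_{i=2}^{s} b_i (h A) (g (U_i) - g (v))`. -/
def step (m : Method) (s : ℕ) (P : ParabolicProblem X) (h : ℝ) (v : X) : X :=
  exponentialEuler P h v +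
    h • ∑ i ∈ Finset.Icc 2 s,
      (m.b i).atSemigroup P.S h (P.g (m.stage P h v i) - P.g v)

/-- The numerical solution after `n` steps of constant size `h`, from `u (t₀)`. -/
def numSol (m : Method) (s : ℕ) (P : ParabolicProblem X) (h : ℝ) (n : ℕ) : X :=
  (m.step s P h)^[n] (P.u P.t₀)

end Scheme

/-- The `s`-stage method `m` is convergent of order `p`: for every semilinear parabolic problem, the
error with constant step size `h` is bounded by `C h ^ p`, uniformly on `[t₀, T]`, with a constant
that depends neither on `n` nor on the (sufficiently small) step size. -/
def ConvergentOfOrder (m : Method) (s p : ℕ) : Prop :=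
  ∀ (X : Type) [NormedAddCommGroup X] [NormedSpace ℂ X] [CompleteSpace X]
    (P : ParabolicProblem X),
    ∃ C h₀ : ℝ, 0 < h₀ ∧ ∀ h : ℝ, 0 < h → h ≤ h₀ → ∀ n : ℕ, P.t₀ + n * h ≤ P.T →
      ‖m.numSol s P h n - P.u (P.t₀ + n * h)‖ ≤ C * h ^ p

end Method

end ExpRK

end

/-!
A linear functional on functions of `x < 0` that annihilates `b 5` and `b 6` turns the weights into
numbers `l 2`, `l 3`, `l 4`. The stage conditions and the nested condition then force all the
moments `∑ l i * c i ^ m`, `m ≥ 1`, to vanish: otherwise the moments would grow like factorials. So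
the quadrature conditions put `φ₂`, `φ₃`, `φ₄` into the span of `b 5` and `b 6`, although the
functions `φ_k` are linearly independent.

Diagonal matrices `Z` with eigenvalues `x`, `y`, `0` reduce the stiff order conditions to scalar
ones. A convergent method satisfies the same scalar conditions: on `c₀`, take a diagonal operator
whose `k`-th eigenvalues are `y / h k` and `x / h k` with `h k → 0`, and a problem whose exact
solution is a polynomial in `t`; the error of the first step of size `h k` is the defect of a
condition times a power of `h k` that is too small for order five.
-/

open scoped ZeroAtInfty BoundedContinuousFunction

namespace ExpRK

/-- The scalar function `φ_k`, with the same case split and integrand as `phiMatrix`. -/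
noncomputable def phi (k : ℕ) (z : ℂ) : ℂ :=
  if k = 0 then Complex.exp z
  else ∫ θ in (0 : ℝ)..1,
    Complex.exp (((1 - θ : ℝ) : ℂ) * z) * ((θ ^ (k - 1) / (k - 1).factorial : ℝ) : ℂ)

theorem phi_zero (z : ℂ) : phi 0 z = Complex.exp z := if_pos rfl

theorem phi_succ (k : ℕ) (z : ℂ) : phi (k + 1) z =
    ∫ θ in (0 : ℝ)..1, Complex.exp (((1 - θ : ℝ) : ℂ) * z) * ((θ ^ k / k.factorial : ℝ) : ℂ) := by
  simp [phi]

theorem hasDerivAt_pow_succ_div_factorial (k : ℕ) (θ : ℝ) :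
    HasDerivAt (fun θ : ℝ => θ ^ (k + 1) / (k + 1).factorial) (θ ^ k / k.factorial) θ := by
  convert! (hasDerivAt_pow (k + 1) θ).div_const ((k + 1).factorial : ℝ) using 1
  rw [Nat.factorial_succ]
  push_cast
  field_simp

theorem phi_apply_zero (k : ℕ) : phi k 0 = 1 / (k.factorial : ℂ) := by
  cases k with
  | zero => simp [phi_zero]
  | succ k =>
    have h := intervalIntegral.integral_eq_sub_of_hasDerivAt (a := 0) (b := 1)
      (fun θ _ => hasDerivAt_pow_succ_div_factorial k θ)
      (Continuous.intervalIntegrable (by fun_prop) _ _)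
    simp only [phi_succ, mul_zero, Complex.exp_zero, one_mul]
    rw [intervalIntegral.integral_ofReal, h]
    simp

theorem hasDerivAt_exp_one_sub_mul (z : ℂ) (θ : ℝ) :
    HasDerivAt (fun θ : ℝ => Complex.exp (((1 - θ : ℝ) : ℂ) * z))
      (-(z * Complex.exp (((1 - θ : ℝ) : ℂ) * z))) θ := by
  convert! (((hasDerivAt_id θ).const_sub 1).ofReal_comp.mul_const z).cexp using 1
  simp only [id_eq, Complex.ofReal_neg, Complex.ofReal_one]
  ring

theorem mul_phi_succ (k : ℕ) (z : ℂ) : z * phi (k + 1) z = phi k z - 1 / (k.factorial : ℂ) := by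
  cases k with
  | zero =>
    have h := intervalIntegral.integral_eq_sub_of_hasDerivAt (a := 0) (b := 1)
      (fun θ _ => hasDerivAt_exp_one_sub_mul z θ)
      (Continuous.intervalIntegrable (by fun_prop) _ _)
    rw [intervalIntegral.integral_neg, intervalIntegral.integral_const_mul] at h
    rw [phi_succ, phi_zero]
    simp only [Complex.ofReal_sub, Complex.ofReal_one, sub_self, Complex.ofReal_zero, zero_mul,
      Complex.exp_zero, sub_zero, one_mul, pow_zero, Nat.factorial_zero, Nat.cast_one, div_one,
      mul_one] at h ⊢
    linear_combination -h
  | succ k =>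
    have h := intervalIntegral.integral_eq_sub_of_hasDerivAt (a := 0) (b := 1)
      (fun θ _ => (hasDerivAt_exp_one_sub_mul z θ).mul
        (hasDerivAt_pow_succ_div_factorial k θ).ofReal_comp)
      (Continuous.intervalIntegrable (by fun_prop) _ _)
    simp only [neg_mul, mul_assoc] at h
    rw [intervalIntegral.integral_add (Continuous.intervalIntegrable (by fun_prop) _ _)
      (Continuous.intervalIntegrable (by fun_prop) _ _),
      intervalIntegral.integral_neg, intervalIntegral.integral_const_mul, ← phi_succ,
      ← phi_succ] at h
    simp only [Complex.ofReal_sub, Complex.ofReal_one, Complex.ofReal_div, Complex.ofReal_pow,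
      Complex.ofReal_natCast, Pi.mul_apply, sub_self, zero_mul, Complex.exp_zero, one_pow, one_mul,
      Complex.ofReal_zero, zero_pow k.succ_ne_zero, zero_div, mul_zero, sub_zero] at h ⊢
    linear_combination -h

theorem hasSum_phi (k : ℕ) (z : ℂ) :
    HasSum (fun n : ℕ => z ^ n / ((n + k).factorial : ℂ)) (phi k z) := by
  rcases eq_or_ne z 0 with rfl | hz
  · rw [phi_apply_zero]
    simpa using hasSum_single (f := fun n : ℕ => (0 : ℂ) ^ n / ((n + k).factorial : ℂ)) 0
      fun n hn => by simp [hn]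
  induction k with
  | zero =>
    rw [phi_zero, Complex.exp_eq_exp_ℂ]
    simpa using NormedSpace.expSeries_div_hasSum_exp z
  | succ k ih =>
    have h := (hasSum_nat_add_iff' 1).mpr ih
    simp only [Finset.range_one, Finset.sum_singleton, pow_zero, zero_add] at h
    rw [← mul_phi_succ] at h
    have h' := h.mul_left z⁻¹
    rw [inv_mul_cancel_left₀ hz] at h'
    convert! h' using 2 with n
    rw [show n + 1 + k = n + (k + 1) by ring]
    field_simp
    ring

theorem continuous_phi (k : ℕ) : Continuous (phi k) := by
  cases k with
  | zero => simpa only [funext phi_zero] using! Complex.continuous_exp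
  | succ k =>
    rw [funext (phi_succ k)]
    exact intervalIntegral.continuous_parametric_intervalIntegral_of_continuous'
      (by fun_prop) _ _

theorem norm_phi_one_le {x : ℝ} (hx : x ≤ 0) : ‖phi 1 x‖ ≤ 1 := by
  rw [phi_succ]
  refine (intervalIntegral.norm_integral_le_of_norm_le_const (C := 1) fun θ hθ => ?_).trans
    (by simp)
  rw [Set.uIoc_of_le zero_le_one] at hθ
  simp only [pow_zero, Nat.factorial_zero, Nat.cast_one, div_one, Complex.ofReal_one, mul_one]
  rw [Complex.norm_exp, Real.exp_le_one_iff, ← Complex.ofReal_mul, Complex.ofReal_re]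
  exact mul_nonpos_of_nonneg_of_nonpos (by linarith [hθ.2]) hx

theorem eq_zero_of_hasSum_mul_pow_zero {f : ℕ → ℂ}
    (h : ∀ y : ℝ, y < 0 → HasSum (fun n => f n * (y : ℂ) ^ n) 0) : f = 0 := by
  set p := FormalMultilinearSeries.ofScalars ℂ f with hp_def
  have hradius : 0 < p.radius := by
    have hterms : Filter.Tendsto (fun n => ‖p n‖ * ((1 : ℝ≥0) : ℝ) ^ n) Filter.atTop (𝓝 0) := by
      simpa [hp_def, FormalMultilinearSeries.ofScalars_norm] using
        (h (-1) (by norm_num)).summable.tendsto_atTop_zero.norm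
    exact lt_of_lt_of_le (by simp) (p.le_radius_of_tendsto hterms)
  have hp := (p.hasFPowerSeriesOnBall hradius).hasFPowerSeriesAt
  have hneg : Filter.Tendsto (fun y : ℝ => (y : ℂ)) (𝓝[<] 0) (𝓝[≠] (0 : ℂ)) :=
    tendsto_nhdsWithin_iff.mpr
      ⟨(Complex.continuous_ofReal.tendsto' 0 0 (by simp)).mono_left nhdsWithin_le_nhds,
        by filter_upwards [self_mem_nhdsWithin] with y hy using by simpa using ne_of_lt hy⟩
  have hfreq : ∃ᶠ z in 𝓝[≠] (0 : ℂ), p.sum z = 0 := by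
    refine hneg.frequently (Filter.Eventually.frequently ?_)
    filter_upwards [self_mem_nhdsWithin] with y hy
    simpa [FormalMultilinearSeries.sum, hp_def, mul_comm] using (h y hy).tsum_eq
  have hzero :=
    hp.eq_zero_of_eventually (hp.analyticAt.frequently_zero_iff_eventually_zero.mp hfreq)
  exact funext fun n => by
    rw [← FormalMultilinearSeries.coeff_ofScalars (𝕜 := ℂ) (p := f) (n := n), ← hp_def, hzero]
    rfl

theorem tendsto_factorial_div_factorial {k j : ℕ} (hkj : k < j) :
    Filter.Tendsto (fun n : ℕ => ((n + k).factorial : ℂ) / (n + j).factorial)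
      Filter.atTop (𝓝 0) := by
  refine squeeze_zero_norm (fun n => ?_) (tendsto_one_div_add_atTop_nhds_zero_nat (𝕜 := ℝ))
  have h : (n + 1) * (n + k).factorial ≤ (n + j).factorial := calc
    (n + 1) * (n + k).factorial ≤ (n + k + 1) * (n + k).factorial := by gcongr; omega
    _ = (n + k + 1).factorial := (Nat.factorial_succ _).symm
    _ ≤ (n + j).factorial := Nat.factorial_le (by omega)
  rw [norm_div, Complex.norm_natCast, Complex.norm_natCast, div_le_div_iff₀ (by positivity)
    (by positivity), one_mul, mul_comm]
  exact_mod_cast h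

theorem eq_zero_of_forall_sum_div_factorial {s : Finset ℕ} {g : ℕ → ℂ}
    (h : ∀ n : ℕ, ∑ j ∈ s, g j / ((n + j).factorial : ℂ) = 0) : ∀ k ∈ s, g k = 0 := by
  intro k
  induction k using Nat.strong_induction_on with
  | _ k ih =>
  intro hk
  have hlim : Filter.Tendsto
      (fun n : ℕ => ∑ j ∈ s, g j * (((n + k).factorial : ℂ) / (n + j).factorial)) Filter.atTop
      (𝓝 (∑ j ∈ s, if j = k then g j else 0)) := by
    refine tendsto_finsetSum _ fun j hj => ?_
    rcases lt_trichotomy j k with hjk | rfl | hjk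
    · simp [ih j hjk hj, hjk.ne]
    · simp [Nat.factorial_ne_zero]
    · simpa [hjk.ne'] using (tendsto_factorial_div_factorial hjk).const_mul (g j)
  have hzero : ∀ n : ℕ, ∑ j ∈ s, g j * (((n + k).factorial : ℂ) / (n + j).factorial) = 0 :=
    fun n => by
      rw [← mul_zero ((n + k).factorial : ℂ), ← h n, Finset.mul_sum]
      exact Finset.sum_congr rfl fun j _ => by ring
  simp only [hzero, Finset.sum_ite_eq', if_pos hk] at hlim
  exact (tendsto_const_nhds_iff.mp hlim).symm

theorem linearIndependent_phi :
    LinearIndependent ℂ fun (k : ℕ) (x : Set.Iio (0 : ℝ)) => phi k ((x : ℝ) : ℂ) := by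
  refine linearIndependent_iff'.mpr fun s g hg => eq_zero_of_forall_sum_div_factorial fun n => ?_
  refine congrFun (eq_zero_of_hasSum_mul_pow_zero
    (f := fun n => ∑ j ∈ s, g j / ((n + j).factorial : ℂ)) fun y hy => ?_) n
  convert! hasSum_sum fun j (_ : j ∈ s) => (hasSum_phi j (y : ℂ)).mul_left (g j) using 1
  · funext n
    rw [Finset.sum_mul]
    exact Finset.sum_congr rfl fun j _ => by ring
  · simpa using (congrFun hg ⟨y, hy⟩).symm

/-- The error, on the monomial `θ ↦ θ ^ p / p!`, of the exponential quadrature rule with nodes `c k`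
and weights `α k`, `k ∈ s`, on an interval of length `γ`. For `γ = 1` it vanishes exactly when the
weights satisfy the stiff quadrature condition with right-hand side `φ_{p+1} (z)`. -/
noncomputable def quadDefect (c : ℕ → ℂ) (s : Finset ℕ) (α : ℕ → ℂ) (γ z : ℂ) (p : ℕ) : ℂ :=
  ∑ k ∈ s, c k ^ p / (p.factorial : ℂ) * α k - γ ^ (p + 1) * phi (p + 1) (γ * z)

/-- The scalar version of `ψ_{p+1,i}`, indexed by the degree `p` of the monomial `θ ^ p / p!` on
which the `i`-th internal stage is tested. -/
noncomputable def stageDefect (c : ℕ → ℂ) (a : ℕ → ℕ → ℂ → ℂ) (p i : ℕ) (z : ℂ) : ℂ :=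
  quadDefect c (Finset.Ico 2 i) (fun k => a i k z) (c i) z p

/-- What the stiff order conditions say about scalar arguments on the negative half-line. The
weights and the internal stages are evaluated at independent points, because the conditions hold
for every matrix `J` between them. The innermost defect of the nested condition is taken at `0`. -/
structure ScalarConditions (c : ℕ → ℂ) (a : ℕ → ℕ → ℂ → ℂ) (b : ℕ → ℂ → ℂ) (s : ℕ) : Prop where
  quadrature : ∀ p ∈ Finset.Icc 1 3, ∀ x : ℝ, x < 0 →
    quadDefect c (Finset.Icc 2 s) (fun i => b i x) 1 x p = 0
  stages : ∀ p ∈ Finset.Icc 1 2, ∀ x y : ℝ, x < 0 → y < 0 →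
    ∑ i ∈ Finset.Icc 2 s, b i x * stageDefect c a p i y = 0
  nested : ∀ x y : ℝ, x < 0 → y < 0 →
    ∑ i ∈ Finset.Icc 2 s, b i x * ∑ j ∈ Finset.Ico 2 i, a i j y * stageDefect c a 1 j 0 = 0

/-- The value of a coefficient function at a complex number. -/
noncomputable def Coeff.eval (f : Coeff) (z : ℂ) : ℂ :=
  f.sum fun p α => α * phi p.1 (((p.2 : ℝ) : ℂ) * z)

theorem exp_diagonal {d : ℕ} (v : Fin d → ℂ) :
    NormedSpace.exp (Matrix.diagonal v) = Matrix.diagonal fun p => Complex.exp (v p) := by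
  rw [Matrix.exp_diagonal]
  congr 1
  funext p
  rw [Pi.coe_exp, Complex.exp_eq_exp_ℂ]

theorem phiMatrix_diagonal {d : ℕ} (k : ℕ) (v : Fin d → ℂ) :
    phiMatrix k (Matrix.diagonal v) = Matrix.diagonal fun p => phi k (v p) := by
  rcases k with _ | k
  · simp [phiMatrix, exp_diagonal, phi_zero]
  · ext p q
    simp only [phiMatrix, ← Matrix.diagonal_smul, exp_diagonal, Nat.add_eq_zero_iff, one_ne_zero,
      and_false, if_false, Matrix.of_apply, Nat.add_sub_cancel]
    rcases eq_or_ne p q with rfl | hpq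
    · simp [phi_succ]
    · simp [Matrix.diagonal_apply_ne _ hpq]

theorem Coeff.atMatrix_diagonal {d : ℕ} (f : Coeff) (v : Fin d → ℂ) :
    f.atMatrix (Matrix.diagonal v) = Matrix.diagonal fun p => f.eval (v p) := by
  simp only [Coeff.atMatrix, ← Matrix.diagonal_smul, phiMatrix_diagonal]
  ext p q
  simp only [Finsupp.sum, Matrix.sum_apply]
  rcases eq_or_ne p q with rfl | hpq
  · simp [Coeff.eval, Finsupp.sum]
  · simp [Matrix.diagonal_apply_ne _ hpq]

theorem Method.psi_diagonal (m : Method) {d : ℕ} (p i : ℕ) (v : Fin d → ℂ) :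
    m.psi (p + 1) i (Matrix.diagonal v) =
      Matrix.diagonal fun q => stageDefect m.node (fun i k => (m.a i k).eval) p i (v q) := by
  simp only [Method.psi, ← Matrix.diagonal_smul, phiMatrix_diagonal, Coeff.atMatrix_diagonal]
  ext q r
  rcases eq_or_ne q r with rfl | hqr
  · simp [stageDefect, quadDefect, Matrix.sum_apply]
  · simp [Matrix.diagonal_apply_ne _ hqr, Matrix.sum_apply]

theorem Method.quadDefect_eq_zero_of_sum_smul_atMatrix {m : Method} {s p : ℕ} {v : Fin 1 → ℂ}
    (h : ∑ i ∈ Finset.Icc 2 s, (m.node i ^ p / (p.factorial : ℂ)) •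
      (m.b i).atMatrix (Matrix.diagonal v) = phiMatrix (p + 1) (Matrix.diagonal v)) :
    quadDefect m.node (Finset.Icc 2 s) (fun i => (m.b i).eval (v 0)) 1 (v 0) p = 0 := by
  simpa [quadDefect, Coeff.atMatrix_diagonal, phiMatrix_diagonal, Matrix.sum_apply, sub_eq_zero]
    using congrFun (congrFun h 0) 0

theorem Method.sum_eval_mul_stageDefect_eq_zero {m : Method} {s p : ℕ} {v : Fin 2 → ℂ}
    (h : ∑ i ∈ Finset.Icc 2 s, (m.b i).atMatrix (Matrix.diagonal v) * Matrix.single 0 1 1 *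
      m.psi (p + 1) i (Matrix.diagonal v) = 0) :
    ∑ i ∈ Finset.Icc 2 s, (m.b i).eval (v 0) *
      stageDefect m.node (fun i k => (m.a i k).eval) p i (v 1) = 0 := by
  simpa [Coeff.atMatrix_diagonal, Method.psi_diagonal, Matrix.sum_apply, Matrix.single_apply]
    using congrFun (congrFun h 0) 1

theorem Method.StiffOrderFour.scalarConditions {m : Method} {s : ℕ} (h : m.StiffOrderFour s) :
    ScalarConditions m.node (fun i k => (m.a i k).eval) (fun i => (m.b i).eval) s where
  quadrature p hp x _ := by
    refine Method.quadDefect_eq_zero_of_sum_smul_atMatrix (v := fun _ => (x : ℂ)) ?_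
    rw [Finset.mem_Icc] at hp
    obtain rfl | rfl | rfl : p = 1 ∨ p = 2 ∨ p = 3 := by omega
    · simpa using h.cond1 1 _
    · simpa using h.cond2 1 _
    · simpa [Nat.factorial] using h.cond4 1 _
  stages p hp x y _ _ := by
    refine Method.sum_eval_mul_stageDefect_eq_zero (v := ![(x : ℂ), y]) ?_
    rw [Finset.mem_Icc] at hp
    obtain rfl | rfl : p = 1 ∨ p = 2 := by omega
    · exact h.cond3 2 _ _
    · exact h.cond5 2 _ _
  nested x y _ _ := by
    have h02 := congrFun (congrFun (h.cond6 3 (Matrix.diagonal ![(x : ℂ), y, 0])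
      (Matrix.single 0 1 1 + Matrix.single 1 2 1)) 0) 2
    simpa [Coeff.atMatrix_diagonal, Method.psi_diagonal m 1, Matrix.sum_apply, Matrix.mul_apply,
      Fin.sum_univ_three, Matrix.single_apply, Matrix.diagonal_apply] using h02

section Diagonal

variable {ι β : Type*} [TopologicalSpace ι] [NormedAddCommGroup β]

theorem norm_c0_le_iff {x : C₀(ι, β)} {C : ℝ} (hC : 0 ≤ C) : ‖x‖ ≤ C ↔ ∀ n, ‖x n‖ ≤ C := by
  rw [← ZeroAtInftyContinuousMap.norm_toBCF_eq_norm, BoundedContinuousFunction.norm_le hC]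
  rfl

theorem norm_c0_apply_le (x : C₀(ι, β)) (n : ι) : ‖x n‖ ≤ ‖x‖ :=
  (norm_c0_le_iff (norm_nonneg x)).mp le_rfl n

/-- Evaluation at a point. -/
noncomputable def evalC0 (n : ι) : C₀(ι, ℂ) →L[ℂ] ℂ :=
  LinearMap.mkContinuous ⟨⟨fun x => x n, fun _ _ => rfl⟩, fun _ _ => rfl⟩ 1 fun x => by
    simpa using norm_c0_apply_le x n

@[simp] theorem evalC0_apply (n : ι) (x : C₀(ι, ℂ)) : evalC0 n x = x n := rfl

theorem sum_c0_apply {α : Type*} (s : Finset α) (f : α → C₀(ι, ℂ)) (n : ι) :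
    (∑ i ∈ s, f i) n = ∑ i ∈ s, f i n :=
  map_sum (evalC0 n) f s

/-- Multiplication of null families by bounded families. -/
noncomputable def diagOp : (ι →ᵇ ℂ) →L[ℂ] C₀(ι, ℂ) →L[ℂ] C₀(ι, ℂ) :=
  LinearMap.mkContinuous₂
    (LinearMap.mk₂ ℂ (fun (m : ι →ᵇ ℂ) (x : C₀(ι, ℂ)) =>
      (⟨⟨fun n => m n * x n, m.continuous.mul (map_continuous x)⟩, by
        refine squeeze_zero_norm (a := fun n => ‖m‖ * ‖x n‖) (fun n => ?_) ?_
        · simp only [norm_mul]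
          gcongr
          exact m.norm_coe_le_norm n
        · simpa using (ZeroAtInftyContinuousMapClass.zero_at_infty x).norm.const_mul ‖m‖⟩ :
        C₀(ι, ℂ)))
      (fun m m' x => ZeroAtInftyContinuousMap.ext fun n => add_mul (m n) (m' n) (x n))
      (fun r m x => ZeroAtInftyContinuousMap.ext fun n => mul_assoc r (m n) (x n))
      (fun m x x' => ZeroAtInftyContinuousMap.ext fun n => mul_add (m n) (x n) (x' n))
      (fun r m x => ZeroAtInftyContinuousMap.ext fun n => mul_left_comm (m n) r (x n)))
    1 fun m x => by
      rw [one_mul, norm_c0_le_iff (by positivity)]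
      intro n
      change ‖m n * x n‖ ≤ _
      rw [norm_mul]
      exact mul_le_mul (m.norm_coe_le_norm n) (norm_c0_apply_le x n) (norm_nonneg _)
        (norm_nonneg _)

@[simp] theorem diagOp_apply (m : ι →ᵇ ℂ) (x : C₀(ι, ℂ)) (n : ι) :
    diagOp m x n = m n * x n := rfl

/-- The graph of the diagonal operator with the eigenvalues `μ`. -/
def diagGraph (μ : ι → ℝ) : Submodule ℂ (C₀(ι, ℂ) × C₀(ι, ℂ)) where
  carrier := {p | ∀ n, p.2 n = μ n * p.1 n}
  add_mem' {p q} hp hq n := by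
    have := hp n
    have := hq n
    simp_all [mul_add]
  zero_mem' n := by simp
  smul_mem' r p hp n := by
    have := hp n
    simp_all [mul_left_comm]

/-- The diagonal operator with the eigenvalues `μ`, on its maximal domain. -/
noncomputable def diagGenerator (μ : ι → ℝ) : C₀(ι, ℂ) →ₗ.[ℂ] C₀(ι, ℂ) :=
  (diagGraph μ).toLinearPMap

theorem mem_graph_diagGenerator {μ : ι → ℝ} {x y : C₀(ι, ℂ)} :
    (x, y) ∈ (diagGenerator μ).graph ↔ ∀ n, y n = μ n * x n := by
  rw [diagGenerator, Submodule.toLinearPMap_graph_eq]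
  · rfl
  · rintro ⟨x, y⟩ h rfl
    ext n
    simpa using h n

variable [DiscreteTopology ι]

theorem tendsto_diagOp_apply {α : Type*} {l : Filter α} {m : α → ι →ᵇ ℂ} {m₀ : ι →ᵇ ℂ}
    (hb : ∀ᶠ a in l, ‖m a‖ ≤ 1) (hb₀ : ‖m₀‖ ≤ 1)
    (hm : ∀ n, Filter.Tendsto (fun a => m a n) l (𝓝 (m₀ n))) (x : C₀(ι, ℂ)) :
    Filter.Tendsto (fun a => diagOp (m a) x) l (𝓝 (diagOp m₀ x)) := by
  rw [Metric.tendsto_nhds]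
  intro ε hε
  have hx : ∀ᶠ n in Filter.cofinite, ‖x n‖ < ε / 4 := by
    rw [← Filter.cocompact_eq_cofinite]
    simpa using (ZeroAtInftyContinuousMapClass.zero_at_infty x).norm.eventually
      (gt_mem_nhds (show ‖(0 : ℂ)‖ < ε / 4 by simpa using (by positivity : 0 < ε / 4)))
  have hfin : ∀ᶠ a in l, ∀ n ∈ {n | ¬ ‖x n‖ < ε / 4}, ‖m a n * x n - m₀ n * x n‖ < ε / 2 := by
    refine (Filter.eventually_all_finite (Filter.eventually_cofinite.mp hx)).mpr fun n _ => ?_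
    have h := ((hm n).mul_const (x n)).sub_const (m₀ n * x n) |>.norm
    rw [sub_self, norm_zero] at h
    exact h.eventually (gt_mem_nhds (by positivity))
  filter_upwards [hfin, hb] with a ha hba
  rw [dist_eq_norm]
  refine lt_of_le_of_lt ((norm_c0_le_iff (by positivity : 0 ≤ ε / 2)).mpr fun n => ?_)
    (by linarith : ε / 2 < ε)
  rw [ZeroAtInftyContinuousMap.sub_apply, diagOp_apply, diagOp_apply]
  by_cases hn : ‖x n‖ < ε / 4
  · calc ‖m a n * x n - m₀ n * x n‖ ≤ ‖m a n * x n‖ + ‖m₀ n * x n‖ := norm_sub_le _ _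
      _ ≤ 1 * (ε / 4) + 1 * (ε / 4) := by
        rw [norm_mul, norm_mul]
        gcongr
        · exact ((m a).norm_coe_le_norm n).trans hba
        · exact (m₀.norm_coe_le_norm n).trans hb₀
      _ = ε / 2 := by ring
  · exact (ha n hn).le

/-- The multiplier `exp (z μ)`, reflected to the right half-plane. -/
noncomputable def expMult (μ : ι → ℝ) (hμ : ∀ n, μ n ≤ 0) (z : ℂ) : ι →ᵇ ℂ :=
  BoundedContinuousFunction.ofNormedAddCommGroupDiscrete
    (fun n => Complex.exp (μ n * (|z.re| + z.im * Complex.I))) 1 fun n => by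
      rw [Complex.norm_exp]
      simpa using mul_nonpos_of_nonpos_of_nonneg (hμ n) (abs_nonneg z.re)

variable {μ : ι → ℝ} {hμ : ∀ n, μ n ≤ 0}

theorem expMult_apply {z : ℂ} (hz : 0 ≤ z.re) (n : ι) :
    expMult μ hμ z n = Complex.exp (μ n * z) := by
  change Complex.exp (μ n * (|z.re| + z.im * Complex.I)) = _
  rw [abs_of_nonneg hz, Complex.re_add_im]

theorem norm_expMult_le (z : ℂ) : ‖expMult μ hμ z‖ ≤ 1 := by
  refine (BoundedContinuousFunction.norm_le zero_le_one).mpr fun n => ?_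
  change ‖Complex.exp (μ n * (|z.re| + z.im * Complex.I))‖ ≤ 1
  rw [Complex.norm_exp]
  simpa using mul_nonpos_of_nonpos_of_nonneg (hμ n) (abs_nonneg z.re)

theorem continuous_expMult_apply (n : ι) : Continuous fun z => expMult μ hμ z n := by
  change Continuous fun z : ℂ => Complex.exp (μ n * (|z.re| + z.im * Complex.I))
  fun_prop

/-- The diagonal semigroup with the eigenvalues `μ`. -/
noncomputable def diagSemigroup (μ : ι → ℝ) (hμ : ∀ n, μ n ≤ 0) (t : ℝ) :
    C₀(ι, ℂ) →L[ℂ] C₀(ι, ℂ) := diagOp (expMult μ hμ t)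

theorem diagSemigroup_apply {t : ℝ} (ht : 0 ≤ t) (x : C₀(ι, ℂ)) (n : ι) :
    diagSemigroup μ hμ t x n = Complex.exp (t * μ n) * x n := by
  rw [diagSemigroup, diagOp_apply, expMult_apply (by simpa using ht), mul_comm (t : ℂ)]

theorem continuous_diagSemigroup_apply (x : C₀(ι, ℂ)) :
    Continuous fun t => diagSemigroup μ hμ t x :=
  continuous_iff_continuousAt.mpr fun t => tendsto_diagOp_apply
    (.of_forall fun _ => norm_expMult_le _) (norm_expMult_le _)
    (fun n => ((continuous_expMult_apply n).comp Complex.continuous_ofReal).tendsto t) x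

theorem sq_mul_exp_neg_le {x ρ : ℝ} (hx : 0 ≤ x) (hρ : 0 < ρ) :
    x ^ 2 * Real.exp (-(x * (ρ / 2))) ≤ 8 / ρ ^ 2 := by
  have h := Real.quadratic_le_exp_of_nonneg (x := x * (ρ / 2)) (by positivity)
  rw [Real.exp_neg, ← div_eq_mul_inv, div_le_div_iff₀ (Real.exp_pos _) (by positivity)]
  have : 0 ≤ x * (ρ / 2) := by positivity
  nlinarith

theorem norm_exp_mul_sub_sub_le {ν : ℝ} (hν : ν ≤ 0) {z w : ℂ} (hz : 0 < z.re)
    (hw : ‖w - z‖ ≤ z.re / 2) :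
    ‖Complex.exp (ν * w) - Complex.exp (ν * z) - (w - z) * (ν * Complex.exp (ν * z))‖ ≤
      8 / z.re ^ 2 * ‖w - z‖ ^ 2 := by
  have h := Complex.norm_exp_sub_sum_le_norm_mul_exp ((ν : ℂ) * (w - z)) 2
  have e : Complex.exp (ν * w) - Complex.exp (ν * z) - (w - z) * (ν * Complex.exp (ν * z)) =
      Complex.exp (ν * z) * (Complex.exp (ν * (w - z)) -
        ∑ m ∈ Finset.range 2, (ν * (w - z)) ^ m / (m.factorial : ℂ)) := by
    rw [show (ν : ℂ) * w = ν * z + ν * (w - z) by ring, Complex.exp_add]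
    simp only [Finset.sum_range_succ, Finset.range_zero, Finset.sum_empty, pow_zero, pow_one,
      Nat.factorial_zero, Nat.factorial_one, Nat.cast_one, div_one]
    ring
  rw [e, norm_mul, Complex.norm_exp]
  have hre : ((ν : ℂ) * z).re = -(-ν * z.re) := by simp
  have hn : ‖(ν : ℂ) * (w - z)‖ = -ν * ‖w - z‖ := by
    rw [norm_mul, Complex.norm_real, Real.norm_of_nonpos hν]
  rw [hn] at h
  rw [hre]
  calc Real.exp (-(-ν * z.re)) * ‖_‖
      ≤ Real.exp (-(-ν * z.re)) * ((-ν * ‖w - z‖) ^ 2 * Real.exp (-ν * (z.re / 2))) := by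
        gcongr
        refine h.trans ?_
        gcongr
        linarith
    _ = ((-ν) ^ 2 * Real.exp (-(-ν * (z.re / 2)))) * ‖w - z‖ ^ 2 := by
        rw [show -(-ν * (z.re / 2)) = -(-ν * z.re) + -ν * (z.re / 2) by ring, Real.exp_add]
        ring
    _ ≤ _ := by
        gcongr
        exact sq_mul_exp_neg_le (by linarith) hz

theorem differentiableAt_expMult {z : ℂ} (hz : 0 < z.re) :
    DifferentiableAt ℂ (expMult μ hμ) z := by
  have hbound : ∀ n, ‖(μ n : ℂ) * Complex.exp (μ n * z)‖ ≤ 1 / z.re := by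
    intro n
    rw [norm_mul, Complex.norm_exp, Complex.norm_real, Real.norm_of_nonpos (hμ n)]
    have hre : ((μ n : ℂ) * z).re = -(-μ n * z.re) := by simp
    rw [hre, Real.exp_neg, ← div_eq_mul_inv, div_le_div_iff₀ (Real.exp_pos _) hz, one_mul]
    linarith [Real.add_one_le_exp (-μ n * z.re)]
  let D : ι →ᵇ ℂ := BoundedContinuousFunction.ofNormedAddCommGroupDiscrete
    (fun n => (μ n : ℂ) * Complex.exp (μ n * z)) (1 / z.re) hbound
  refine HasDerivAt.differentiableAt (f' := D) ?_
  rw [hasDerivAt_iff_isLittleO]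
  refine Asymptotics.IsBigO.trans_isLittleO (g := fun w => ‖w - z‖ ^ 2) ?_
    (Asymptotics.isLittleO_pow_sub_sub z one_lt_two)
  refine Asymptotics.IsBigO.of_bound (8 / z.re ^ 2) ?_
  filter_upwards [Metric.closedBall_mem_nhds z (half_pos hz)] with w hw
  rw [mem_closedBall_iff_norm] at hw
  rw [norm_pow, norm_norm, BoundedContinuousFunction.norm_le (by positivity)]
  intro n
  have hwre : 0 ≤ w.re := by
    have h1 := (Complex.abs_re_le_norm (w - z)).trans hw
    rw [Complex.sub_re] at h1
    linarith [(abs_le.mp h1).1]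
  have := norm_exp_mul_sub_sub_le (hμ n) hz hw
  rw [← expMult_apply (hμ := hμ) hwre, ← expMult_apply (hμ := hμ) hz.le] at this
  have hD : D n = μ n * expMult μ hμ z n := by rw [expMult_apply hz.le]; rfl
  rw [← hD] at this
  exact this

theorem mem_sector_pi_div_two {z : ℂ} : z ∈ sector (Real.pi / 2) ↔ 0 < z.re := by
  rw [sector, Set.mem_ofPred_eq, Complex.abs_arg_lt_pi_div_two_iff]
  constructor
  · rintro ⟨h0, h | h⟩
    · exact h
    · exact absurd h h0
  · intro h
    exact ⟨fun h0 => by simp [h0] at h, Or.inl h⟩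

theorem isAnalyticSemigroup_diagSemigroup : IsAnalyticSemigroup (diagSemigroup μ hμ) := by
  refine ⟨Real.pi / 2, by positivity, le_rfl, fun z => diagOp (expMult μ hμ z),
    fun t _ => rfl, ?_, ?_, ?_, ?_⟩
  · ext x n
    simp [expMult_apply]
  · intro z hz w hw
    rw [mem_sector_pi_div_two] at hz hw
    ext x n
    simp only [diagOp_apply, ContinuousLinearMap.comp_apply]
    rw [expMult_apply (by simpa using (add_pos hz hw).le), expMult_apply hz.le,
      expMult_apply hw.le, mul_add, Complex.exp_add, mul_assoc]
  · intro z hz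
    rw [mem_sector_pi_div_two] at hz
    have hd : DifferentiableAt ℂ (fun m : ι →ᵇ ℂ => diagOp m) (expMult μ hμ z) :=
      ContinuousLinearMap.differentiableAt _
    exact (hd.comp z (differentiableAt_expMult hz)).differentiableWithinAt
  · intro x
    have h := tendsto_diagOp_apply (l := 𝓝[sector (Real.pi / 2)] 0) (m := expMult μ hμ)
      (m₀ := expMult μ hμ 0)
      (.of_forall fun _ => norm_expMult_le _) (norm_expMult_le _)
      (fun n => ((continuous_expMult_apply n).tendsto 0).mono_left nhdsWithin_le_nhds) x
    convert! h using 2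
    ext n
    simp [expMult_apply]

/-- The multiplier `φ_1 (t μ)`, reflected to `t ≥ 0` so that it is bounded for every `t`. -/
noncomputable def phiOneMult (μ : ι → ℝ) (hμ : ∀ n, μ n ≤ 0) (t : ℝ) : ι →ᵇ ℂ :=
  BoundedContinuousFunction.ofNormedAddCommGroupDiscrete
    (fun n => phi 1 ((|t| * μ n : ℝ) : ℂ)) 1 fun n =>
      norm_phi_one_le (mul_nonpos_of_nonneg_of_nonpos (abs_nonneg t) (hμ n))

theorem phiOneMult_apply (t : ℝ) (n : ι) :
    phiOneMult μ hμ t n = phi 1 ((|t| * μ n : ℝ) : ℂ) := rfl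

theorem norm_phiOneMult_le (t : ℝ) : ‖phiOneMult μ hμ t‖ ≤ 1 :=
  (BoundedContinuousFunction.norm_le zero_le_one).mpr fun n =>
    norm_phi_one_le (mul_nonpos_of_nonneg_of_nonpos (abs_nonneg t) (hμ n))

theorem inv_smul_diagSemigroup_sub {t : ℝ} (ht : 0 < t) {x y : C₀(ι, ℂ)}
    (hxy : ∀ n, y n = μ n * x n) :
    t⁻¹ • (diagSemigroup μ hμ t x - x) = diagOp (phiOneMult μ hμ t) y := by
  ext n
  have hphi := mul_phi_succ 0 ((t * μ n : ℝ) : ℂ)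
  have htne : (t : ℂ) ≠ 0 := by exact_mod_cast ht.ne'
  simp only [ZeroAtInftyContinuousMap.smul_apply, ZeroAtInftyContinuousMap.sub_apply,
    diagSemigroup_apply ht.le, diagOp_apply, phiOneMult_apply, abs_of_pos ht, hxy n,
    Complex.real_smul]
  simp only [phi_zero, zero_add, Nat.factorial_zero] at hphi
  push_cast at hphi ⊢
  field_simp
  linear_combination -x n * hphi

theorem tendsto_diagSemigroup_slope {x y : C₀(ι, ℂ)} (hxy : ∀ n, y n = μ n * x n) :
    Filter.Tendsto (fun t : ℝ => t⁻¹ • (diagSemigroup μ hμ t x - x)) (𝓝[>] 0) (𝓝 y) := by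
  have hlim := tendsto_diagOp_apply (l := 𝓝[>] (0 : ℝ)) (m := phiOneMult μ hμ)
    (m₀ := phiOneMult μ hμ 0) (.of_forall norm_phiOneMult_le) (norm_phiOneMult_le 0) (fun n => by
      have hc : Continuous fun t : ℝ => phi 1 ((|t| * μ n : ℝ) : ℂ) :=
        (continuous_phi 1).comp (by fun_prop)
      exact (hc.tendsto 0).mono_left nhdsWithin_le_nhds) y
  have hzero : diagOp (phiOneMult μ hμ 0) y = y := by
    ext n
    simp [phiOneMult_apply, phi_apply_zero]
  rw [hzero] at hlim
  refine hlim.congr' ?_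
  filter_upwards [self_mem_nhdsWithin] with t ht using (inv_smul_diagSemigroup_sub ht hxy).symm

theorem eq_mul_of_tendsto_diagSemigroup_slope {x y : C₀(ι, ℂ)}
    (h : Filter.Tendsto (fun t : ℝ => t⁻¹ • (diagSemigroup μ hμ t x - x)) (𝓝[>] 0) (𝓝 y)) (n : ι) :
    y n = μ n * x n := by
  have hderiv : HasDerivAt (fun t : ℝ => Complex.exp (t * μ n) * x n) (μ n * x n) 0 := by
    simpa using (((Complex.ofRealCLM.hasDerivAt (x := 0)).mul_const (μ n : ℂ)).cexp).mul_const (x n)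
  refine tendsto_nhds_unique ((((evalC0 n).continuous.tendsto y).comp h).congr' ?_)
    hderiv.tendsto_slope_zero_right
  filter_upwards [self_mem_nhdsWithin] with t ht
  simp [diagSemigroup_apply (le_of_lt ht)]

theorem isGenerator_diagGenerator : IsGenerator (diagGenerator μ) (diagSemigroup μ hμ) :=
  fun _ _ => mem_graph_diagGenerator.trans
    ⟨tendsto_diagSemigroup_slope, eq_mul_of_tendsto_diagSemigroup_slope⟩

theorem phiSemigroup_diagSemigroup_apply (k : ℕ) {t : ℝ} (ht : 0 ≤ t) (x : C₀(ι, ℂ)) (n : ι) :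
    phiSemigroup (diagSemigroup μ hμ) k t x n = phi k (t * μ n) * x n := by
  cases k with
  | zero => simp [phiSemigroup, phi_zero, diagSemigroup_apply ht]
  | succ k =>
    have hc : Continuous fun θ : ℝ => (θ ^ k / k.factorial : ℝ) •
        diagSemigroup μ hμ ((1 - θ) * t) x := by
      have h1 : Continuous fun θ : ℝ => diagSemigroup μ hμ ((1 - θ) * t) x :=
        (continuous_diagSemigroup_apply x).comp
          (by fun_prop : Continuous fun θ : ℝ => (1 - θ) * t)
      fun_prop
    have h := (evalC0 n).intervalIntegral_comp_comm
      (hc.intervalIntegrable (μ := MeasureTheory.volume) 0 1)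
    simp only [phiSemigroup, Nat.add_eq_zero_iff, one_ne_zero, and_false, if_false,
      Nat.add_sub_cancel]
    rw [← evalC0_apply, ← h, phi_succ, ← intervalIntegral.integral_mul_const]
    refine intervalIntegral.integral_congr fun θ hθ => ?_
    rw [Set.uIcc_of_le zero_le_one] at hθ
    have hθt : 0 ≤ (1 - θ) * t := mul_nonneg (by linarith [hθ.2]) ht
    simp only [evalC0_apply, ZeroAtInftyContinuousMap.smul_apply, diagSemigroup_apply hθt,
      Complex.real_smul]
    push_cast
    ring_nf

theorem Coeff.atSemigroup_diagSemigroup_apply (f : Coeff) {h : ℝ} (hh : 0 ≤ h) (x : C₀(ι, ℂ))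
    (n : ι) : f.atSemigroup (diagSemigroup μ hμ) h x n = f.eval (h * μ n) * x n := by
  rw [Coeff.atSemigroup, Finsupp.sum, sum_c0_apply, Coeff.eval, Finsupp.sum, Finset.sum_mul]
  refine Finset.sum_congr rfl fun p _ => ?_
  rw [ZeroAtInftyContinuousMap.smul_apply,
    phiSemigroup_diagSemigroup_apply _ (by positivity)]
  simp only [smul_eq_mul]
  push_cast
  ring_nf

end Diagonal

section Step

variable {ι : Type*} [TopologicalSpace ι] [DiscreteTopology ι] {μ : ι → ℝ} {hμ : ∀ n, μ n ≤ 0}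

theorem exponentialEuler_apply {P : ParabolicProblem C₀(ι, ℂ)} (hP : P.S = diagSemigroup μ hμ)
    {τ : ℝ} (hτ : 0 ≤ τ) (v : C₀(ι, ℂ)) (n : ι) :
    Method.exponentialEuler P τ v n =
      Complex.exp (τ * μ n) * v n + τ * (phi 1 (τ * μ n) * P.g v n) := by
  rw [Method.exponentialEuler, ZeroAtInftyContinuousMap.add_apply,
    ZeroAtInftyContinuousMap.smul_apply, hP, diagSemigroup_apply hτ,
    phiSemigroup_diagSemigroup_apply 1 hτ, Complex.real_smul]

theorem stage_apply (m : Method) {P : ParabolicProblem C₀(ι, ℂ)} (hP : P.S = diagSemigroup μ hμ)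
    {h : ℝ} (hh : 0 ≤ h) (v : C₀(ι, ℂ)) (i : ℕ) (n : ι) :
    m.stage P h v i n = Complex.exp (m.node i * (h * μ n)) * v n +
      m.node i * h * (phi 1 (m.node i * (h * μ n)) * P.g v n) +
      h * ∑ j ∈ Finset.Ico 2 i,
        (m.a i j).eval (h * μ n) * (P.g (m.stage P h v j) n - P.g v n) := by
  rw [Method.stage, ZeroAtInftyContinuousMap.add_apply, ZeroAtInftyContinuousMap.smul_apply,
    exponentialEuler_apply hP (by positivity),
    Finset.sum_coe_sort (Finset.Ico 2 i) fun j =>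
      (m.a i j).atSemigroup P.S h (P.g (m.stage P h v j) - P.g v),
    sum_c0_apply, Complex.real_smul]
  simp only [hP, Coeff.atSemigroup_diagSemigroup_apply _ hh,
    ZeroAtInftyContinuousMap.sub_apply, Method.node, Complex.ofReal_mul, mul_assoc]

theorem step_apply (m : Method) (s : ℕ) {P : ParabolicProblem C₀(ι, ℂ)}
    (hP : P.S = diagSemigroup μ hμ) {h : ℝ} (hh : 0 ≤ h) (v : C₀(ι, ℂ)) (n : ι) :
    m.step s P h v n = Complex.exp (h * μ n) * v n + h * (phi 1 (h * μ n) * P.g v n) +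
      h * ∑ i ∈ Finset.Icc 2 s,
        (m.b i).eval (h * μ n) * (P.g (m.stage P h v i) n - P.g v n) := by
  rw [Method.step, ZeroAtInftyContinuousMap.add_apply, ZeroAtInftyContinuousMap.smul_apply,
    exponentialEuler_apply hP hh, sum_c0_apply, Complex.real_smul]
  simp only [hP, Coeff.atSemigroup_diagSemigroup_apply _ hh,
    ZeroAtInftyContinuousMap.sub_apply]

end Step

section BoundedDerivatives

variable {𝕜 X Y E : Type*} [NontriviallyNormedField 𝕜] [NormedAddCommGroup X] [NormedSpace 𝕜 X]
  [NormedAddCommGroup Y] [NormedSpace 𝕜 Y] [NormedAddCommGroup E] [NormedSpace 𝕜 E]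

theorem exists_norm_iteratedFDeriv_clm_le (Λ : X →L[𝕜] Y) {s : Set X}
    (hs : Bornology.IsBounded s) (k : ℕ) :
    ∃ B : ℝ, ∀ x ∈ s, ‖iteratedFDeriv 𝕜 k Λ x‖ ≤ B := by
  rcases k with _ | k
  · obtain ⟨R, hR⟩ := hs.exists_norm_le
    refine ⟨‖Λ‖ * R, fun x hx => ?_⟩
    rw [norm_iteratedFDeriv_zero]
    exact (Λ.le_opNorm x).trans (by gcongr; exact hR x hx)
  · have hfderiv : fderiv 𝕜 Λ = fun _ => Λ := funext fun x => Λ.fderiv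
    refine ⟨‖Λ‖, fun x _ => ?_⟩
    rw [← norm_iteratedFDeriv_fderiv, hfderiv]
    rcases k with _ | k
    · rw [norm_iteratedFDeriv_zero]
    · simp [iteratedFDeriv_const_of_ne k.succ_ne_zero]

theorem exists_norm_iteratedFDeriv_comp_clm_le [ProperSpace E] {G : E → Y} (hG : ContDiff 𝕜 ∞ G)
    (τ : X →L[𝕜] E) {s : Set X} (hs : Bornology.IsBounded s) (k : ℕ) :
    ∃ B : ℝ, ∀ x ∈ s, ‖iteratedFDeriv 𝕜 k (G ∘ τ) x‖ ≤ B := by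
  have hGk : ContDiff 𝕜 k G := hG.of_le (by exact_mod_cast le_top)
  obtain ⟨R, hR⟩ := hs.exists_norm_le
  obtain ⟨B, hB⟩ := (isCompact_closedBall (0 : E) (‖τ‖ * R)).exists_bound_of_continuousOn
    (hG.continuous_iteratedFDeriv (m := k) (by exact_mod_cast le_top)).continuousOn
  refine ⟨B * ‖τ‖ ^ k, fun x hx => ?_⟩
  rw [τ.iteratedFDeriv_comp_right hGk x (i := k) le_rfl]
  refine (ContinuousMultilinearMap.norm_compContinuousLinearMap_le _ _).trans ?_
  rw [Finset.prod_const, Finset.card_univ, Fintype.card_fin]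
  gcongr
  refine hB _ (mem_closedBall_zero_iff.mpr ?_)
  exact (τ.le_opNorm x).trans (by gcongr; exact hR x hx)

theorem exists_norm_iteratedFDeriv_comp_add_clm_le [ProperSpace E] {G : E → Y}
    (hG : ContDiff 𝕜 ∞ G) (τ : X →L[𝕜] E) (Λ : X →L[𝕜] Y) {s : Set X}
    (hs : Bornology.IsBounded s) (k : ℕ) :
    ∃ B : ℝ, ∀ x ∈ s, ‖iteratedFDeriv 𝕜 k (fun u => G (τ u) + Λ u) x‖ ≤ B := by
  obtain ⟨B₁, hB₁⟩ := exists_norm_iteratedFDeriv_comp_clm_le hG τ hs k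
  obtain ⟨B₂, hB₂⟩ := exists_norm_iteratedFDeriv_clm_le Λ hs k
  have hGk : ContDiff 𝕜 k G := hG.of_le (by exact_mod_cast le_top)
  refine ⟨B₁ + B₂, fun x hx => ?_⟩
  have hadd := iteratedFDeriv_add_apply (i := k) (x := x) (hGk.comp τ.contDiff).contDiffAt
    Λ.contDiff.contDiffAt
  exact (congrArg norm hadd).trans_le ((norm_add_le _ _).trans (add_le_add (hB₁ x hx) (hB₂ x hx)))

end BoundedDerivatives

/-- The components of a test problem: the time, its integral, a family driven by the time, and a
family that observes the error of the driven family. -/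
inductive TestIndex
  | time
  | integral
  | driven (k : ℕ)
  | observing (k : ℕ)

namespace TestIndex

instance : TopologicalSpace TestIndex := ⊥

instance : DiscreteTopology TestIndex := ⟨rfl⟩

theorem driven_injective : Function.Injective driven := fun _ _ h => by injection h

end TestIndex

/-- The state of a test problem with prescribed components, as a null family. -/
noncomputable def assemble : ℂ × ℂ × C₀(ℕ, ℂ) × C₀(ℕ, ℂ) →L[ℂ] C₀(TestIndex, ℂ) :=
  LinearMap.mkContinuous
    { toFun := fun z =>
        { toFun := fun
            | .time => z.1
            | .integral => z.2.1
            | .driven k => z.2.2.1 k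
            | .observing k => z.2.2.2 k
          continuous_toFun := continuous_of_discreteTopology
          zero_at_infty' := by
            have hfin (x : C₀(ℕ, ℂ)) {ε : ℝ} (hε : 0 < ε) : {k | ¬ ‖x k‖ < ε}.Finite := by
              have hx := (ZeroAtInftyContinuousMapClass.zero_at_infty x).norm.eventually
                (gt_mem_nhds (show ‖(0 : ℂ)‖ < ε by simpa using hε))
              rwa [Filter.cocompact_eq_cofinite] at hx
            rw [Filter.cocompact_eq_cofinite, Metric.tendsto_nhds]
            intro ε hε
            refine ((Set.toFinite {TestIndex.time, TestIndex.integral}).union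
              (((hfin z.2.2.1 hε).image TestIndex.driven).union
                ((hfin z.2.2.2 hε).image TestIndex.observing))).subset ?_
            rintro (_ | _ | k | k) hn <;> simp_all }
      map_add' := fun z z' => by ext n; cases n <;> rfl
      map_smul' := fun r z => by ext n; cases n <;> rfl }
    1 fun z => by
      rw [one_mul, norm_c0_le_iff (norm_nonneg z)]
      have h1 := norm_snd_le z
      have h2 := (norm_snd_le z.2).trans h1
      rintro (_ | _ | k | k)
      · exact norm_fst_le z
      · exact (norm_fst_le z.2).trans h1
      · exact (norm_c0_apply_le _ k).trans ((norm_fst_le z.2.2).trans h2)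
      · exact (norm_c0_apply_le _ k).trans ((norm_snd_le z.2.2).trans h2)

section Assemble

variable (z : ℂ × ℂ × C₀(ℕ, ℂ) × C₀(ℕ, ℂ)) (k : ℕ)

@[simp] theorem assemble_time : assemble z .time = z.1 := rfl

@[simp] theorem assemble_integral : assemble z .integral = z.2.1 := rfl

@[simp] theorem assemble_driven : assemble z (.driven k) = z.2.2.1 k := rfl

@[simp] theorem assemble_observing : assemble z (.observing k) = z.2.2.2 k := rfl

end Assemble

/-- The driven family of a state of a test problem. -/
noncomputable def drivenPart : C₀(TestIndex, ℂ) →L[ℂ] C₀(ℕ, ℂ) :=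
  LinearMap.mkContinuous
    (ZeroAtInftyContinuousMap.compLinearMap
      { toFun := TestIndex.driven
        continuous_toFun := continuous_of_discreteTopology
        cocompact_tendsto' := by
          simpa only [Filter.cocompact_eq_cofinite] using
            TestIndex.driven_injective.tendsto_cofinite })
    1 fun x => by
      rw [one_mul, norm_c0_le_iff (norm_nonneg x)]
      exact fun k => norm_c0_apply_le x _

@[simp] theorem drivenPart_apply (x : C₀(TestIndex, ℂ)) (k : ℕ) :
    drivenPart x k = x (.driven k) := rfl

/-- The parameters of a test problem. The driven family of its exact solution is
`t ^ (degree + 1) / (degree + 1)! • w`, and `v = A w`. The sequence `e` couples the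
driven family to the error of the component `t ^ 2 / 2`. -/
structure TestData where
  drivenRate : ℕ → ℝ
  observingRate : ℕ → ℝ
  drivenRate_nonpos : ∀ k, drivenRate k ≤ 0
  observingRate_nonpos : ∀ k, observingRate k ≤ 0
  degree : ℕ
  w : C₀(ℕ, ℂ)
  v : C₀(ℕ, ℂ)
  e : C₀(ℕ, ℂ)
  v_apply : ∀ k, v k = drivenRate k * w k

namespace TestData

variable (D : TestData)

/-- The eigenvalues of the linear part of the test problem. -/
def rate : TestIndex → ℝ
  | .time => 0
  | .integral => 0
  | .driven k => D.drivenRate k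
  | .observing k => D.observingRate k

theorem rate_nonpos : ∀ n, D.rate n ≤ 0
  | .time => le_rfl
  | .integral => le_rfl
  | .driven k => D.drivenRate_nonpos k
  | .observing k => D.observingRate_nonpos k

/-- The exact solution of the test problem; its observing family vanishes. -/
noncomputable def solution (t : ℝ) : C₀(TestIndex, ℂ) :=
  assemble (t, (t ^ 2 / 2 : ℝ),
    (t ^ (D.degree + 1) / (D.degree + 1).factorial : ℝ) • D.w, 0)

/-- The part of the nonlinearity that depends on the time component only. -/
noncomputable def forcing (z : ℂ) : C₀(TestIndex, ℂ) :=
  assemble (1, z,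
    (z ^ D.degree / (D.degree.factorial : ℂ)) • D.w -
      (z ^ (D.degree + 1) / ((D.degree + 1).factorial : ℂ)) • D.v + (z ^ 2 / 2) • D.e,
    -(z ^ (D.degree + 1) / ((D.degree + 1).factorial : ℂ)) • D.w)

/-- The part of the nonlinearity that is linear in the state. -/
noncomputable def feedback : C₀(TestIndex, ℂ) →L[ℂ] C₀(TestIndex, ℂ) :=
  assemble.comp ((0 : _ →L[ℂ] ℂ).prod ((0 : _ →L[ℂ] ℂ).prod
    ((-(evalC0 .integral).smulRight D.e).prod drivenPart)))

theorem contDiff_forcing : ContDiff ℂ ∞ D.forcing := by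
  unfold forcing
  fun_prop

theorem contDiff_solution : ContDiff ℝ ∞ D.solution := by
  have hofReal : ContDiff ℝ ∞ fun t : ℝ => (t : ℂ) := Complex.ofRealCLM.contDiff
  refine (assemble.restrictScalars ℝ).contDiff.comp (hofReal.prodMk (.prodMk ?_ ?_))
  · exact hofReal.comp (by fun_prop)
  · fun_prop

theorem hasDerivAt_solution (t : ℝ) :
    HasDerivAt D.solution
      (assemble (1, t, (t ^ D.degree / D.degree.factorial : ℝ) • D.w, 0)) t := by
  have hsq : HasDerivAt (fun t : ℝ => t ^ 2 / 2) t t := by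
    simpa using (hasDerivAt_pow 2 t).div_const 2
  exact (assemble.restrictScalars ℝ).hasFDerivAt.comp_hasDerivAt t
    (Complex.ofRealCLM.hasDerivAt.prodMk (hsq.ofReal_comp.prodMk
      (((hasDerivAt_pow_succ_div_factorial D.degree t).smul_const D.w).prodMk
        (hasDerivAt_const t 0))))

/-- A diagonal problem with a polynomial exact solution. -/
noncomputable def problem : ParabolicProblem C₀(TestIndex, ℂ) where
  A := diagGenerator D.rate
  S := diagSemigroup D.rate D.rate_nonpos
  g u := D.forcing (evalC0 .time u) + D.feedback u
  t₀ := 0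
  T := 1
  u := D.solution
  lt := zero_lt_one
  analytic := isAnalyticSemigroup_diagSemigroup
  generator := isGenerator_diagGenerator
  smooth_u := D.contDiff_solution.contDiffOn
  solution t ht := by
    rw [mem_graph_diagGenerator,
      (D.hasDerivAt_solution t).hasDerivWithinAt.derivWithin (uniqueDiffOn_Icc zero_lt_one t ht)]
    rintro (_ | _ | k | k) <;> simp [forcing, feedback, solution, rate, D.v_apply]
    ring
  smooth_g := by
    refine ⟨1, one_pos, ContDiff.contDiffOn ?_, fun k =>
      exists_norm_iteratedFDeriv_comp_add_clm_le D.contDiff_forcing _ _ ?_ k⟩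
    · exact (D.contDiff_forcing.comp (evalC0 _).contDiff).add D.feedback.contDiff
    · exact (isCompact_Icc.image D.contDiff_solution.continuous).isBounded.thickening

end TestData

theorem quadrature_error (c : ℕ → ℂ) (s : Finset ℕ) (α q : ℕ → ℂ) (γ : ℂ) {z h w v : ℂ} (e : ℂ)
    (hv : h * v = z * w) (p : ℕ) :
    γ * h * (phi 1 (γ * z) * (0 ^ p / (p.factorial : ℂ) * w)) +
      h * ∑ k ∈ s, α k * ((c k * h) ^ p / (p.factorial : ℂ) * w -
        (c k * h) ^ (p + 1) / ((p + 1).factorial : ℂ) * v - h ^ 2 * q k * e -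
        0 ^ p / (p.factorial : ℂ) * w) -
      (γ * h) ^ (p + 1) / ((p + 1).factorial : ℂ) * w =
    h ^ (p + 1) * w * ((1 - 0 ^ p) * quadDefect c s α γ z p - z * quadDefect c s α γ z (p + 1)) -
      h ^ 3 * e * ∑ k ∈ s, α k * q k := by
  have hsum : ∑ k ∈ s, α k * ((c k * h) ^ p / (p.factorial : ℂ) * w -
      (c k * h) ^ (p + 1) / ((p + 1).factorial : ℂ) * v - h ^ 2 * q k * e -
      0 ^ p / (p.factorial : ℂ) * w) =
      (∑ k ∈ s, c k ^ p / (p.factorial : ℂ) * α k) * (h ^ p * w) -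
      (∑ k ∈ s, c k ^ (p + 1) / ((p + 1).factorial : ℂ) * α k) * (h ^ (p + 1) * v) -
      (∑ k ∈ s, α k * q k) * (h ^ 2 * e) - (∑ k ∈ s, α k) * (0 ^ p / (p.factorial : ℂ) * w) := by
    simp only [Finset.sum_mul, ← Finset.sum_sub_distrib]
    exact Finset.sum_congr rfl fun k _ => by ring
  have hphi := mul_phi_succ (p + 1) (γ * z)
  rw [hsum, quadDefect, quadDefect]
  rcases p with _ | p
  · simp only [zero_add, Nat.reduceAdd, Nat.factorial_one, Nat.cast_one, ne_eq, one_ne_zero,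
      not_false_eq_true, div_self, pow_zero, Nat.factorial_zero, one_mul, pow_one, div_one,
      sub_self, zero_mul, zero_sub, mul_neg] at hphi ⊢
    linear_combination -(h * ∑ k ∈ s, c k * α k) * hv - γ * h * w * hphi
  · simp only [zero_pow p.succ_ne_zero]
    linear_combination -(h ^ (p + 2) * ∑ k ∈ s, c k ^ (p + 2) / ((p + 2).factorial : ℂ) * α k) * hv
      - (γ * h) ^ (p + 2) * w * hphi

theorem eq_zero_of_telescoping {D : ℕ → ℂ} {x : ℂ} {N : ℕ} (hx : x ≠ 0)
    (h : ∀ p ≤ N, (1 - 0 ^ p) * D p - x * D (p + 1) = 0) : ∀ p ≤ N, D (p + 1) = 0 := by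
  intro p hp
  have hprev : (1 - 0 ^ p) * D p = 0 := by
    induction p with
    | zero => simp
    | succ p ih =>
      have := h p (by omega)
      rw [ih (by omega), zero_sub, neg_eq_zero] at this
      rw [(mul_eq_zero.mp this).resolve_left hx, mul_zero]
  have := h p hp
  rw [hprev, zero_sub, neg_eq_zero] at this
  exact (mul_eq_zero.mp this).resolve_left hx

namespace TestData

variable (D : TestData) (u : C₀(TestIndex, ℂ)) (k : ℕ)

theorem problem_g_time : D.problem.g u .time = 1 := by
  simp [problem, forcing, feedback]

theorem problem_g_integral : D.problem.g u .integral = u .time := by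
  simp [problem, forcing, feedback]

theorem problem_g_driven : D.problem.g u (.driven k) =
    u .time ^ D.degree / (D.degree.factorial : ℂ) * D.w k -
      u .time ^ (D.degree + 1) / ((D.degree + 1).factorial : ℂ) * D.v k +
      (u .time ^ 2 / 2 - u .integral) * D.e k := by
  simp only [problem, forcing, evalC0_apply, feedback, ContinuousLinearMap.comp_apply,
    ContinuousLinearMap.prod_apply, zero_apply, neg_apply, ContinuousLinearMap.smulRight_apply,
    ZeroAtInftyContinuousMap.add_apply, assemble_driven, ZeroAtInftyContinuousMap.sub_apply,
    ZeroAtInftyContinuousMap.smul_apply, smul_eq_mul, ZeroAtInftyContinuousMap.neg_apply]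
  ring

theorem problem_g_observing : D.problem.g u (.observing k) =
    u (.driven k) - u .time ^ (D.degree + 1) / ((D.degree + 1).factorial : ℂ) * D.w k := by
  simp only [problem, forcing, evalC0_apply, feedback, ContinuousLinearMap.comp_apply,
    ContinuousLinearMap.prod_apply, ZeroAtInftyContinuousMap.add_apply, assemble_observing,
    ZeroAtInftyContinuousMap.smul_apply, smul_eq_mul, drivenPart_apply]
  ring

variable (m : Method) {h : ℝ} (hh : 0 ≤ h) (i : ℕ)

include hh

theorem stage_time : m.stage D.problem h 0 i .time = m.node i * h := by
  rw [stage_apply m (P := D.problem) rfl hh]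
  simp [problem_g_time, rate, phi_apply_zero]

theorem stage_integral : m.stage D.problem h 0 i .integral =
    h ^ 2 * ∑ j ∈ Finset.Ico 2 i, (m.a i j).eval 0 * m.node j := by
  rw [stage_apply m (P := D.problem) rfl hh]
  simp only [problem_g_integral, D.stage_time m hh, rate, ZeroAtInftyContinuousMap.zero_apply,
    Complex.ofReal_zero, mul_zero, zero_add, sub_zero, Finset.mul_sum]
  exact Finset.sum_congr rfl fun j _ => by ring

theorem problem_g_stage_driven : D.problem.g (m.stage D.problem h 0 i) (.driven k) =
    (m.node i * h) ^ D.degree / (D.degree.factorial : ℂ) * D.w k -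
      (m.node i * h) ^ (D.degree + 1) / ((D.degree + 1).factorial : ℂ) * D.v k -
      h ^ 2 * stageDefect m.node (fun i k => (m.a i k).eval) 1 i 0 * D.e k := by
  rw [problem_g_driven, D.stage_time m hh, D.stage_integral m hh]
  simp only [stageDefect, quadDefect, mul_zero, phi_apply_zero, pow_one, Nat.factorial_one,
    Nat.cast_one, div_one, mul_comm (m.node _) ((m.a i _).eval 0)]
  ring

variable {z z' : ℂ} (hz : h * D.drivenRate k = z)

include hz

theorem stage_driven_error : m.stage D.problem h 0 i (.driven k) -
      (m.node i * h) ^ (D.degree + 1) / ((D.degree + 1).factorial : ℂ) * D.w k =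
    h ^ (D.degree + 1) * D.w k *
      ((1 - 0 ^ D.degree) * stageDefect m.node (fun i k => (m.a i k).eval) D.degree i z -
        z * stageDefect m.node (fun i k => (m.a i k).eval) (D.degree + 1) i z) -
    h ^ 3 * D.e k * ∑ j ∈ Finset.Ico 2 i,
      (m.a i j).eval z * stageDefect m.node (fun i k => (m.a i k).eval) 1 j 0 := by
  have hv : (h : ℂ) * D.v k = z * D.w k := by rw [D.v_apply, ← mul_assoc, hz]
  have hz : (h : ℂ) * D.rate (.driven k) = z := hz
  rw [stageDefect, stageDefect, ← quadrature_error _ _ _ _ _ _ hv,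
    stage_apply m (P := D.problem) rfl hh]
  simp only [D.problem_g_stage_driven _ m hh, hz]
  simp [problem_g_driven]

theorem step_driven_error (s : ℕ) : m.step s D.problem h 0 (.driven k) -
      (h : ℂ) ^ (D.degree + 1) / ((D.degree + 1).factorial : ℂ) * D.w k =
    h ^ (D.degree + 1) * D.w k * ((1 - 0 ^ D.degree) *
        quadDefect m.node (Finset.Icc 2 s) (fun i => (m.b i).eval z) 1 z D.degree -
      z * quadDefect m.node (Finset.Icc 2 s) (fun i => (m.b i).eval z) 1 z (D.degree + 1)) -
    h ^ 3 * D.e k * ∑ i ∈ Finset.Icc 2 s,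
      (m.b i).eval z * stageDefect m.node (fun i k => (m.a i k).eval) 1 i 0 := by
  have hv : (h : ℂ) * D.v k = z * D.w k := by rw [D.v_apply, ← mul_assoc, hz]
  have hz : (h : ℂ) * D.rate (.driven k) = z := hz
  rw [← quadrature_error _ _ _ _ _ _ hv, step_apply m s (P := D.problem) rfl hh]
  simp only [D.problem_g_stage_driven _ m hh, hz]
  simp [problem_g_driven]

theorem step_observing (hz' : h * D.observingRate k = z') (s : ℕ) :
    m.step s D.problem h 0 (.observing k) =
    h * ∑ i ∈ Finset.Icc 2 s, (m.b i).eval z' * (h ^ (D.degree + 1) * D.w k *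
      ((1 - 0 ^ D.degree) * stageDefect m.node (fun i k => (m.a i k).eval) D.degree i z -
        z * stageDefect m.node (fun i k => (m.a i k).eval) (D.degree + 1) i z) -
    h ^ 3 * D.e k * ∑ j ∈ Finset.Ico 2 i,
      (m.a i j).eval z * stageDefect m.node (fun i k => (m.a i k).eval) 1 j 0) := by
  have hz' : (h : ℂ) * D.rate (.observing k) = z' := hz'
  rw [step_apply m s (P := D.problem) rfl hh]
  simp only [problem_g_observing, D.stage_time m hh, hz', D.stage_driven_error k m hh _ hz]
  simp

end TestData

theorem Method.ConvergentOfOrder.step_isBigO {m : Method} {s p : ℕ} (hm : m.ConvergentOfOrder s p)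
    {X : Type} [NormedAddCommGroup X] [NormedSpace ℂ X] [CompleteSpace X]
    (P : ParabolicProblem X) :
    (fun h => m.step s P h (P.u P.t₀) - P.u (P.t₀ + h)) =O[𝓝[>] 0] fun h => h ^ p := by
  obtain ⟨C, h₀, hh₀, hC⟩ := hm X P
  refine Asymptotics.IsBigO.of_bound C ?_
  filter_upwards [Ioc_mem_nhdsGT hh₀, Ioc_mem_nhdsGT (sub_pos.mpr P.lt)] with h hh hT
  have hstep := hC h hh.1 hh.2 1 (by simpa using le_sub_iff_add_le'.mp hT.2)
  rw [Real.norm_of_nonneg (pow_nonneg hh.1.le p)]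
  simpa [Method.numSol] using hstep

theorem eq_zero_of_pow_mul_isBigO_pow {α : Type*} {l : Filter α} [l.NeBot] {ε : α → ℝ}
    (hε : Filter.Tendsto ε l (𝓝[≠] 0)) {q r : ℕ} (hrq : r < q) {Q : ℂ}
    (h : (fun a => (ε a : ℂ) ^ r * Q) =O[l] fun a => ε a ^ q) : Q = 0 := by
  have hne : ∀ᶠ a in l, ε a ≠ 0 := hε.eventually self_mem_nhdsWithin
  have hQ : (fun _ : α => Q) =O[l] fun a => ε a ^ (q - r) := by
    refine ((Asymptotics.isBigO_refl (fun a => (ε a ^ r)⁻¹) l).smul h).congr' ?_ ?_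
    · filter_upwards [hne] with a ha
      have : (ε a : ℂ) ≠ 0 := by exact_mod_cast ha
      rw [Complex.real_smul]
      push_cast
      field_simp
    · filter_upwards [hne] with a ha
      rw [smul_eq_mul, pow_sub₀ _ ha hrq.le, mul_comm]
  have hlim : Filter.Tendsto (fun a => ε a ^ (q - r)) l (𝓝 0) := by
    simpa [zero_pow (Nat.sub_ne_zero_of_lt hrq)] using
      (hε.mono_right nhdsWithin_le_nhds).pow (q - r)
  exact tendsto_const_nhds_iff.mp (hQ.trans_tendsto hlim)

/-- The small parameter of the test problems, which are run with the step sizes `eps k ^ 2`. -/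
noncomputable def eps (k : ℕ) : ℝ := ((k : ℝ) + 1)⁻¹

theorem eps_pos (k : ℕ) : 0 < eps k := by
  unfold eps
  positivity

theorem tendsto_eps : Filter.Tendsto eps Filter.atTop (𝓝[>] 0) :=
  tendsto_inv_atTop_nhdsGT_zero.comp
    (Filter.tendsto_atTop_add_const_right _ 1 tendsto_natCast_atTop_atTop)

/-- The null sequence `eps ^ q`. -/
noncomputable def epsPow (q : ℕ) [NeZero q] : C₀(ℕ, ℂ) where
  toFun k := (eps k : ℂ) ^ q
  continuous_toFun := continuous_of_discreteTopology
  zero_at_infty' := by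
    rw [Filter.cocompact_eq_cofinite, Nat.cofinite_eq_atTop]
    have h := (Complex.continuous_ofReal.tendsto 0).comp (tendsto_eps.mono_right nhdsWithin_le_nhds)
    simpa [zero_pow (NeZero.ne q)] using h.pow q

@[simp] theorem epsPow_apply (q : ℕ) [NeZero q] (k : ℕ) : epsPow q k = (eps k : ℂ) ^ q := rfl

section Necessary

variable {m : Method} {s : ℕ} {x y : ℝ} (hx : x ≤ 0) (hy : y ≤ 0) (p : ℕ) (δ η : ℂ)

/-- The test problem whose `k`-th driven and observing components have the eigenvalues `y` and `x`
relative to the step size `eps k ^ 2`. -/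
noncomputable def scaledData : TestData where
  drivenRate k := y / eps k ^ 2
  observingRate k := x / eps k ^ 2
  drivenRate_nonpos k := div_nonpos_of_nonpos_of_nonneg hy (by positivity)
  observingRate_nonpos k := div_nonpos_of_nonpos_of_nonneg hx (by positivity)
  degree := p
  w := δ • epsPow 3
  v := (δ * y) • epsPow 1
  e := η • epsPow 1
  v_apply k := by
    have : (eps k : ℂ) ≠ 0 := by exact_mod_cast (eps_pos k).ne'
    simp only [ZeroAtInftyContinuousMap.smul_apply, epsPow_apply, smul_eq_mul]
    push_cast
    field_simp

theorem TestData.step_apply_isBigO (D : TestData) (hm : m.ConvergentOfOrder s 5)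
    (n : ℕ → TestIndex) :
    (fun k => m.step s D.problem (eps k ^ 2) 0 (n k) - D.solution (eps k ^ 2) (n k))
      =O[Filter.atTop] fun k => eps k ^ 10 := by
  have hsq : Filter.Tendsto (fun k => eps k ^ 2) Filter.atTop (𝓝[>] 0) := by
    refine tendsto_nhdsWithin_iff.mpr ⟨?_, .of_forall fun k => pow_pos (eps_pos k) 2⟩
    simpa using (tendsto_eps.mono_right nhdsWithin_le_nhds).pow 2
  have h0 : D.solution 0 = 0 := by
    ext n
    cases n <;> simp [TestData.solution]
  have hstep : _ =O[Filter.atTop] fun k => eps k ^ 10 :=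
    ((hm.step_isBigO D.problem).comp_tendsto hsq).congr_right fun k =>
      show (eps k ^ 2) ^ 5 = eps k ^ 10 by ring
  refine Asymptotics.IsBigO.trans (.of_norm_le fun k => ?_) hstep.norm_left
  simpa [TestData.problem, h0] using norm_c0_apply_le
    (m.step s D.problem (eps k ^ 2) 0 - D.solution (eps k ^ 2)) (n k)

theorem eps_sq_mul_div (x : ℝ) (k : ℕ) :
    ((eps k ^ 2 : ℝ) : ℂ) * ((x / eps k ^ 2 : ℝ) : ℂ) = x := by
  rw [← Complex.ofReal_mul, mul_div_cancel₀ _ (pow_pos (eps_pos k) 2).ne']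

namespace Method.ConvergentOfOrder

variable (hm : m.ConvergentOfOrder s 5)

include hm

theorem driven_defect (hx : x ≤ 0) {p : ℕ} (hp : p ≤ 2) :
    (1 - 0 ^ p) * quadDefect m.node (Finset.Icc 2 s) (fun i => (m.b i).eval x) 1 x p -
      x * quadDefect m.node (Finset.Icc 2 s) (fun i => (m.b i).eval x) 1 x (p + 1) = 0 := by
  let D := scaledData hx hx p 1 0
  have hO := D.step_apply_isBigO hm .driven
  refine eq_zero_of_pow_mul_isBigO_pow (tendsto_eps.mono_right (nhdsGT_le_nhdsNE 0))
    (by omega : 2 * p + 5 < 10) (hO.congr_left fun k => ?_)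
  have herror := D.step_driven_error k m (sq_nonneg (eps k)) (eps_sq_mul_div x k) s
  have hsol : D.solution (eps k ^ 2) (.driven k) =
      ((eps k ^ 2 : ℝ) : ℂ) ^ (D.degree + 1) / ((D.degree + 1).factorial : ℂ) * D.w k := by
    simp [TestData.solution]
  have hw : D.w k = (eps k : ℂ) ^ 3 := by simp [D, scaledData]
  have he : D.e k = 0 := by simp [D, scaledData]
  rw [hsol, herror, hw, he, show D.degree = p from rfl]
  push_cast
  ring

theorem observing_defect (hx : x ≤ 0) (hy : y ≤ 0) {p : ℕ} (hp : p ≤ 1) :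
    ∑ i ∈ Finset.Icc 2 s, (m.b i).eval x *
      ((1 - 0 ^ p) * stageDefect m.node (fun i k => (m.a i k).eval) p i y -
        y * stageDefect m.node (fun i k => (m.a i k).eval) (p + 1) i y) = 0 := by
  let D := scaledData hx hy p 1 0
  have hO := D.step_apply_isBigO hm .observing
  refine eq_zero_of_pow_mul_isBigO_pow (tendsto_eps.mono_right (nhdsGT_le_nhdsNE 0))
    (by omega : 2 * p + 7 < 10) (hO.congr_left fun k => ?_)
  rw [D.step_observing k m (sq_nonneg (eps k)) (eps_sq_mul_div y k) (eps_sq_mul_div x k)]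
  have hw : D.w k = (eps k : ℂ) ^ 3 := by simp [D, scaledData]
  have he : D.e k = 0 := by simp [D, scaledData]
  have hsol : D.solution (eps k ^ 2) (.observing k) = 0 := by simp [TestData.solution]
  rw [hsol, hw, he, show D.degree = p from rfl, sub_zero, Finset.mul_sum, Finset.mul_sum]
  push_cast
  exact Finset.sum_congr rfl fun i _ => by ring

theorem nested_defect (hx : x ≤ 0) (hy : y ≤ 0) :
    ∑ i ∈ Finset.Icc 2 s, (m.b i).eval x * ∑ j ∈ Finset.Ico 2 i,
      (m.a i j).eval y * stageDefect m.node (fun i k => (m.a i k).eval) 1 j 0 = 0 := by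
  let D := scaledData hx hy 0 0 (-1)
  have hO := D.step_apply_isBigO hm .observing
  refine eq_zero_of_pow_mul_isBigO_pow (tendsto_eps.mono_right (nhdsGT_le_nhdsNE 0))
    (by omega : 9 < 10) (hO.congr_left fun k => ?_)
  rw [D.step_observing k m (sq_nonneg (eps k)) (eps_sq_mul_div y k) (eps_sq_mul_div x k)]
  have hw : D.w k = 0 := by simp [D, scaledData]
  have he : D.e k = -eps k := by simp [D, scaledData]
  have hsol : D.solution (eps k ^ 2) (.observing k) = 0 := by simp [TestData.solution]
  rw [hsol, hw, he, sub_zero, Finset.mul_sum, Finset.mul_sum]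
  push_cast
  exact Finset.sum_congr rfl fun i _ => by ring

theorem scalarConditions :
    ScalarConditions m.node (fun i k => (m.a i k).eval) (fun i => (m.b i).eval) s where
  quadrature p hp x hx := by
    obtain ⟨hp1, hp3⟩ := Finset.mem_Icc.mp hp
    obtain ⟨p, rfl⟩ := Nat.exists_eq_add_of_le' hp1
    exact eq_zero_of_telescoping (by exact_mod_cast hx.ne)
      (fun _ hp => hm.driven_defect hx.le hp) p (by omega)
  stages p hp x y hx hy := by
    obtain ⟨hp1, hp2⟩ := Finset.mem_Icc.mp hp
    obtain ⟨p, rfl⟩ := Nat.exists_eq_add_of_le' hp1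
    refine eq_zero_of_telescoping (x := y) (N := 1) (by exact_mod_cast hy.ne)
      (D := fun p => ∑ i ∈ Finset.Icc 2 s, (m.b i).eval x *
        stageDefect m.node (fun i k => (m.a i k).eval) p i y) (fun p hp => ?_) p (by omega)
    refine Eq.trans ?_ (hm.observing_defect hx.le hy.le hp)
    rw [Finset.mul_sum, Finset.mul_sum, ← Finset.sum_sub_distrib]
    exact Finset.sum_congr rfl fun i _ => by ring
  nested x y hx hy := hm.nested_defect hx.le hy.le

end Method.ConvergentOfOrder

end Necessary

section Moments

theorem sum_mul_pow_eq_zero_of_forall_add {ι K : Type*} [Field K] {s : Finset ι} {l c : ι → K}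
    {N m : ℕ} (hm : m ≠ 0) (h : ∀ n : ℕ, ∑ i ∈ s, l i * c i ^ (n + N) = 0) :
    ∑ i ∈ s, l i * c i ^ m = 0 := by
  classical
  -- Interpolation at the nodes makes `c ^ m` a polynomial combination of the powers `c ^ (n + N)`.
  let q := Lagrange.interpolate (s.image c) id fun x => x ^ m * (x⁻¹) ^ N
  have hq : ∀ i ∈ s, c i ^ m = q.eval (c i) * c i ^ N := fun i hi => by
    have heval : q.eval (c i) = c i ^ m * (c i)⁻¹ ^ N :=
      Lagrange.eval_interpolate_at_node (v := id) _ Function.injective_id.injOn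
        (Finset.mem_image_of_mem c hi)
    rw [heval, mul_assoc, ← mul_pow]
    rcases eq_or_ne (c i) 0 with hc | hc
    · simp [hc, hm]
    · simp [hc]
  calc ∑ i ∈ s, l i * c i ^ m
      = ∑ i ∈ s, ∑ n ∈ Finset.range (q.natDegree + 1), q.coeff n * (l i * c i ^ (n + N)) := by
        refine Finset.sum_congr rfl fun i hi => ?_
        rw [hq i hi, Polynomial.eval_eq_sum_range, Finset.sum_mul, Finset.mul_sum]
        exact Finset.sum_congr rfl fun n _ => by ring
    _ = 0 := by
        rw [Finset.sum_comm]
        exact Finset.sum_eq_zero fun n _ => by rw [← Finset.mul_sum, h n, mul_zero]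

theorem eq_zero_of_factorial_growth {E : Type*} [NormedAddCommGroup E] {G : ℕ → E} {ε A M : ℝ}
    (hε : 0 < ε) (hlow : ∀ n : ℕ, ε * (n + 1) * ‖G n‖ ≤ ‖G (n + 1)‖)
    (hup : ∀ n : ℕ, ‖G n‖ ≤ A * M ^ n) : G 0 = 0 := by
  have hfact : ∀ n : ℕ, ε ^ n * n.factorial * ‖G 0‖ ≤ ‖G n‖ := fun n => by
    induction n with
    | zero => simp
    | succ n ih => calc
        ε ^ (n + 1) * (n + 1).factorial * ‖G 0‖ = ε * (n + 1) * (ε ^ n * n.factorial * ‖G 0‖) := by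
          rw [Nat.factorial_succ]
          push_cast
          ring
        _ ≤ ε * (n + 1) * ‖G n‖ := by gcongr
        _ ≤ ‖G (n + 1)‖ := hlow n
  have hle : ∀ n : ℕ, ‖G 0‖ ≤ A * ((M / ε) ^ n / n.factorial) := fun n => by
    rw [div_pow, div_div, ← mul_div_assoc, le_div_iff₀ (by positivity), mul_comm ‖G 0‖]
    exact (hfact n).trans (hup n)
  have hlim := (FloorSemiring.tendsto_pow_div_factorial_atTop (M / ε)).const_mul A
  rw [mul_zero] at hlim
  exact norm_le_zero_iff.mp (ge_of_tendsto' hlim hle)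

variable {ι : Type*} {s : Finset ι} {l c : ι → ℂ}

theorem norm_sum_mul_pow_le (s : Finset ι) (l c : ι → ℂ) (n : ℕ) :
    ‖∑ i ∈ s, l i * c i ^ n‖ ≤ (∑ i ∈ s, ‖l i‖) * (∑ i ∈ s, ‖c i‖) ^ n := by
  rw [Finset.sum_mul]
  refine (norm_sum_le _ _).trans (Finset.sum_le_sum fun i hi => ?_)
  rw [norm_mul, norm_pow]
  gcongr
  exact Finset.single_le_sum (f := fun i => ‖c i‖) (fun _ _ => norm_nonneg _) hi

theorem sum_mul_pow_eq_zero_of_succ_eq_mul {N m : ℕ} {κ : ℂ} (hm : m ≠ 0)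
    (h : ∀ n : ℕ, ∑ i ∈ s, l i * c i ^ (n + N + 1) =
      κ * (n + N + 1) * ∑ i ∈ s, l i * c i ^ (n + N)) :
    ∑ i ∈ s, l i * c i ^ m = 0 := by
  rcases eq_or_ne κ 0 with rfl | hκ
  · exact sum_mul_pow_eq_zero_of_forall_add (N := N + 1) hm fun n => by
      simpa [add_assoc] using h n
  refine sum_mul_pow_eq_zero_of_forall_add (N := N) hm fun n => ?_
  have h0 : ∑ i ∈ s, l i * c i ^ (0 + N) = 0 := by
    refine eq_zero_of_factorial_growth (G := fun n => ∑ i ∈ s, l i * c i ^ (n + N))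
      (A := (∑ i ∈ s, ‖l i‖) * (∑ i ∈ s, ‖c i‖) ^ N) (M := ∑ i ∈ s, ‖c i‖)
      (norm_pos_iff.mpr hκ) (fun n => ?_) fun n =>
        (norm_sum_mul_pow_le s l c _).trans_eq (by ring)
    rw [add_right_comm, h n, norm_mul, norm_mul]
    gcongr
    rw [show (n : ℂ) + N + 1 = ((n + N + 1 : ℕ) : ℂ) by push_cast; rfl, Complex.norm_natCast]
    push_cast
    linarith [(Nat.cast_nonneg N : (0 : ℝ) ≤ N)]
  induction n with
  | zero => exact h0
  | succ n ih => rw [add_right_comm, h n, ih, mul_zero]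

theorem hasSum_sum_mul_phi (s : Finset ι) (l c : ι → ℂ) (k : ℕ) (y : ℂ) :
    HasSum (fun n : ℕ => (∑ i ∈ s, l i * c i ^ (n + k)) / ((n + k).factorial : ℂ) * y ^ n)
      (∑ i ∈ s, l i * (c i ^ k * phi k (c i * y))) := by
  convert! hasSum_sum (s := s) fun i _ => (hasSum_phi k (c i * y)).mul_left (l i * c i ^ k) using 1
  · funext n
    rw [Finset.sum_div, Finset.sum_mul]
    exact Finset.sum_congr rfl fun i _ => by ring
  · exact Finset.sum_congr rfl fun i _ => by ring

theorem sum_mul_pow_eq_zero_of_sum_mul_phi_eq_zero {k : ℕ}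
    (h : ∀ y : ℝ, y < 0 → ∑ i ∈ s, l i * (c i ^ k * phi k (c i * y)) = 0) (n : ℕ) :
    ∑ i ∈ s, l i * c i ^ (n + k) = 0 := by
  have hcoeff := congrFun (eq_zero_of_hasSum_mul_pow_zero
    fun y hy => h y hy ▸ hasSum_sum_mul_phi s l c k (y : ℂ)) n
  simpa [Nat.factorial_ne_zero] using hcoeff

theorem sum_mul_pow_succ_of_sum_mul_phi_succ {k : ℕ} {κ : ℂ}
    (h : ∀ y : ℝ, y < 0 → ∑ i ∈ s, l i * (c i ^ (k + 1) * phi (k + 1) (c i * y)) =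
      κ * ∑ i ∈ s, l i * (c i ^ k * phi k (c i * y))) (n : ℕ) :
    ∑ i ∈ s, l i * c i ^ (n + k + 1) = κ * (n + k + 1) * ∑ i ∈ s, l i * c i ^ (n + k) := by
  have hcoeff := congrFun (eq_zero_of_hasSum_mul_pow_zero
    (f := fun n => (∑ i ∈ s, l i * c i ^ (n + (k + 1))) / ((n + (k + 1)).factorial : ℂ) -
      κ * ((∑ i ∈ s, l i * c i ^ (n + k)) / ((n + k).factorial : ℂ))) fun y hy => by
      have hdiff := (hasSum_sum_mul_phi s l c (k + 1) (y : ℂ)).sub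
        ((hasSum_sum_mul_phi s l c k (y : ℂ)).mul_left κ)
      rw [h y hy, sub_self] at hdiff
      convert! hdiff using 2 with n
      ring) n
  have hne : ((n + k).factorial : ℂ) ≠ 0 := Nat.cast_ne_zero.mpr (Nat.factorial_ne_zero _)
  have hne' : (n + k + 1 : ℂ) ≠ 0 := by exact_mod_cast Nat.succ_ne_zero (n + k)
  simp only [← add_assoc, Nat.factorial_succ, Pi.zero_apply] at hcoeff
  push_cast at hcoeff
  field_simp at hcoeff
  linear_combination hcoeff

end Moments

theorem eq_zero_or_exists_eq_mul {T K : Type*} [Field K] [NeZero (2 : K)] {c₂ c₃ α : K}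
    {r₂ r₃ S₂ S₃ : T → K}
    (h₂ : ∀ y, S₂ y = r₂ y * c₂ + r₃ y * c₃)
    (h₃ : ∀ y, S₃ y = r₂ y * (c₂ ^ 2 / 2) + r₃ y * (c₃ ^ 2 / 2))
    (hnested : ∀ y, r₂ y * (c₂ ^ 2 / 2) = r₃ y * (α * c₂ - c₃ ^ 2 / 2)) :
    (∀ y, S₂ y = 0) ∨ ∃ κ, ∀ y, S₃ y = κ * S₂ y := by
  have two_ne : (2 : K) ≠ 0 := NeZero.ne 2
  have h₃' : ∀ y, S₃ y = r₃ y * (α * c₂) := fun y => by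
    linear_combination h₃ y + hnested y
  rcases eq_or_ne c₂ 0 with rfl | hc₂
  · left
    intro y
    have hr : r₃ y * c₃ ^ 2 = 0 := by
      have := hnested y
      field_simp at this
      linear_combination this
    rcases mul_eq_zero.mp hr with hr | hc₃
    · simp [h₂, hr]
    · simp [h₂, pow_eq_zero_iff two_ne_zero |>.mp hc₃]
  set ρ := (2 * (α * c₂) - c₃ ^ 2) / c₂ ^ 2 with hρ
  have hr₂ : ∀ y, r₂ y = ρ * r₃ y := fun y => by
    have := hnested y
    rw [hρ]
    field_simp at this ⊢
    linear_combination this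
  have h₂' : ∀ y, S₂ y = r₃ y * (ρ * c₂ + c₃) := fun y => by
    rw [h₂, hr₂]
    ring
  rcases eq_or_ne (ρ * c₂ + c₃) 0 with hzero | hne
  · exact .inl fun y => by rw [h₂', hzero, mul_zero]
  · refine .inr ⟨α * c₂ / (ρ * c₂ + c₃), fun y => ?_⟩
    rw [h₃', h₂', mul_left_comm (_ / _), div_mul_cancel₀ _ hne]

theorem sum_mul_pow_eq_zero_of_stageDefect {c l : ℕ → ℂ} {a : ℕ → ℕ → ℂ → ℂ}
    (hstages : ∀ p ∈ Finset.Icc 1 2, ∀ y : ℝ, y < 0 →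
      ∑ i ∈ Finset.Icc 2 4, l i * stageDefect c a p i y = 0)
    (hnested : ∀ y : ℝ, y < 0 →
      ∑ i ∈ Finset.Icc 2 4, l i * ∑ j ∈ Finset.Ico 2 i, a i j y * stageDefect c a 1 j 0 = 0)
    {m : ℕ} (hm : m ≠ 0) : ∑ i ∈ Finset.Icc 2 4, l i * c i ^ m = 0 := by
  have hIcc (f : ℕ → ℂ) : ∑ i ∈ Finset.Icc 2 4, f i = f 2 + f 3 + f 4 := by
    rw [show Finset.Icc 2 4 = {2, 3, 4} by decide]
    simp [add_assoc]
  have hIco₃ (f : ℕ → ℂ) : ∑ j ∈ Finset.Ico 2 3, f j = f 2 := by simp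
  have hIco₄ (f : ℕ → ℂ) : ∑ j ∈ Finset.Ico 2 4, f j = f 2 + f 3 := by
    rw [Finset.sum_Ico_succ_top (by norm_num), hIco₃]
  have hdich := eq_zero_or_exists_eq_mul (T := Set.Iio (0 : ℝ)) (c₂ := c 2) (c₃ := c 3)
    (α := a 3 2 0) (r₂ := fun y => l 3 * a 3 2 (y : ℝ) + l 4 * a 4 2 (y : ℝ))
    (r₃ := fun y => l 4 * a 4 3 (y : ℝ))
    (S₂ := fun y => ∑ i ∈ Finset.Icc 2 4, l i * (c i ^ 2 * phi 2 (c i * (y : ℝ))))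
    (S₃ := fun y => ∑ i ∈ Finset.Icc 2 4, l i * (c i ^ 3 * phi 3 (c i * (y : ℝ))))
    (fun y => by
      have := hstages 1 (by decide) y y.2
      simp only [stageDefect, quadDefect, hIcc, hIco₃, hIco₄, Finset.Ico_self,
        Finset.sum_empty, Nat.reduceAdd, Nat.factorial_one, Nat.cast_one] at this ⊢
      linear_combination -this)
    (fun y => by
      have := hstages 2 (by decide) y y.2
      simp only [stageDefect, quadDefect, hIcc, hIco₃, hIco₄, Finset.Ico_self,
        Finset.sum_empty, Nat.reduceAdd, Nat.factorial_two, Nat.cast_ofNat] at this ⊢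
      linear_combination -this)
    (fun y => by
      have := hnested y y.2
      simp only [stageDefect, quadDefect, hIcc, hIco₃, hIco₄, Finset.Ico_self,
        Finset.sum_empty, Nat.reduceAdd, Nat.factorial_one, Nat.factorial_two, Nat.cast_one,
        Nat.cast_ofNat, phi_apply_zero, mul_zero] at this ⊢
      linear_combination -this)
  rcases hdich with hzero | ⟨κ, hκ⟩
  · exact sum_mul_pow_eq_zero_of_forall_add hm
      (sum_mul_pow_eq_zero_of_sum_mul_phi_eq_zero fun y hy => hzero ⟨y, hy⟩)
  · exact sum_mul_pow_eq_zero_of_succ_eq_mul (N := 2) hm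
      (sum_mul_pow_succ_of_sum_mul_phi_succ fun y hy => hκ ⟨y, hy⟩)

namespace ScalarConditions

variable {c : ℕ → ℂ} {a : ℕ → ℕ → ℂ → ℂ} {b : ℕ → ℂ → ℂ} {s t : ℕ}

theorem extend (h : ScalarConditions c a b s) (hst : s ≤ t) :
    ScalarConditions c a (fun i z => if i ≤ s then b i z else 0) t := by
  have hsum : ∀ (x : ℂ) (F : ℕ → ℂ), ∑ i ∈ Finset.Icc 2 t, (if i ≤ s then b i x else 0) * F i =
      ∑ i ∈ Finset.Icc 2 s, b i x * F i := fun x F => by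
    rw [← Finset.sum_subset (Finset.Icc_subset_Icc_right hst) fun i hi hi' => by
      rw [if_neg fun his => hi' (Finset.mem_Icc.mpr ⟨(Finset.mem_Icc.mp hi).1, his⟩), zero_mul]]
    exact Finset.sum_congr rfl fun i hi => by rw [if_pos (Finset.mem_Icc.mp hi).2]
  exact
    { quadrature := fun p hp x hx => by
        simpa only [quadDefect, mul_comm (_ / _ : ℂ), hsum] using h.quadrature p hp x hx
      stages := fun p hp x y hx hy => (hsum _ _).trans (h.stages p hp x y hx hy)
      nested := fun x y hx hy => (hsum _ _).trans (h.nested x y hx hy) }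

theorem map_phi_eq_zero (h : ScalarConditions c a b 6) (L : (Set.Iio (0 : ℝ) → ℂ) →ₗ[ℂ] ℂ)
    (h₅ : L (fun x => b 5 (x : ℝ)) = 0) (h₆ : L (fun x => b 6 (x : ℝ)) = 0) {k : ℕ}
    (hk : k ∈ Finset.Icc 2 4) : L (fun x => phi k (x : ℝ)) = 0 := by
  set l : ℕ → ℂ := fun i => L fun x => b i (x : ℝ)
  have hL : ∀ f : ℕ → ℂ, L (fun x => ∑ i ∈ Finset.Icc 2 6, b i (x : ℝ) * f i) =
      ∑ i ∈ Finset.Icc 2 4, l i * f i := fun f => by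
    have hsmul : (fun x : Set.Iio (0 : ℝ) => ∑ i ∈ Finset.Icc 2 6, b i (x : ℝ) * f i) =
        ∑ i ∈ Finset.Icc 2 6, f i • fun x : Set.Iio (0 : ℝ) => b i (x : ℝ) := by
      funext x
      simp [mul_comm]
    rw [hsmul, map_sum, Finset.sum_Icc_succ_top (by norm_num),
      Finset.sum_Icc_succ_top (by norm_num)]
    simp [h₅, h₆, l, mul_comm]
  have hL0 : ∀ f : ℕ → ℂ, (∀ x : ℝ, x < 0 → ∑ i ∈ Finset.Icc 2 6, b i x * f i = 0) →
      ∑ i ∈ Finset.Icc 2 4, l i * f i = 0 := fun f hf => by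
    rw [← hL, show (fun x : Set.Iio (0 : ℝ) => ∑ i ∈ Finset.Icc 2 6, b i (x : ℝ) * f i) = 0 from
      funext fun x => hf x x.2, map_zero]
  obtain ⟨p, rfl⟩ : ∃ p, k = p + 1 := ⟨k - 1, by have := Finset.mem_Icc.mp hk; omega⟩
  have hp : p ∈ Finset.Icc 1 3 := by simp only [Finset.mem_Icc] at hk ⊢; omega
  have hphi : (fun x : Set.Iio (0 : ℝ) => phi (p + 1) (x : ℝ)) =
      fun x : Set.Iio (0 : ℝ) => ∑ i ∈ Finset.Icc 2 6, b i (x : ℝ) *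
        (c i ^ p / (p.factorial : ℂ)) := funext fun x => by
    have := h.quadrature p hp x x.2
    simp only [quadDefect, one_pow, one_mul, sub_eq_zero] at this
    simp only [← this, mul_comm]
  have hmoment := sum_mul_pow_eq_zero_of_stageDefect (l := l)
    (fun p hp y hy => hL0 _ fun x hx => h.stages p hp x y hx hy)
    (fun y hy => hL0 _ fun x hx => h.nested x y hx hy)
    (m := p) (by have := Finset.mem_Icc.mp hp; omega)
  rw [hphi, hL]
  simp only [← mul_div_assoc]
  rw [← Finset.sum_div, hmoment, zero_div]

end ScalarConditions

end ExpRK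

theorem theorem5p1_general (s : ℕ) (hs : s ≤ 6) :
    ¬ ∃ (c : ℕ → ℂ) (a : ℕ → ℕ → ℂ → ℂ) (b : ℕ → ℂ → ℂ), ExpRK.ScalarConditions c a b s := by
  classical
  rintro ⟨c, a, b, h⟩
  set B : ℕ → Set.Iio (0 : ℝ) → ℂ := fun i x => if i ≤ s then b i (x : ℝ) else 0
  let φ : Fin 3 → Set.Iio (0 : ℝ) → ℂ := fun m x => ExpRK.phi (m + 2) (x : ℝ)
  let W : Finset (Set.Iio (0 : ℝ) → ℂ) := {B 5, B 6}
  have hspan : Set.range φ ⊆ Submodule.span ℂ (W : Set (Set.Iio (0 : ℝ) → ℂ)) := by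
    rintro _ ⟨m, rfl⟩
    by_contra hm
    obtain ⟨L, hLm, hLW⟩ := Submodule.exists_le_ker_of_notMem hm
    have hL : ∀ f ∈ W, L f = 0 := fun f hf => hLW (Submodule.subset_span hf)
    exact hLm ((h.extend hs).map_phi_eq_zero L (hL (B 5) (by simp [W])) (hL (B 6) (by simp [W]))
      (Finset.mem_Icc.mpr ⟨by omega, by omega⟩))
  have hli : LinearIndependent ℂ φ :=
    ExpRK.linearIndependent_phi.comp (fun m : Fin 3 => (m : ℕ) + 2) fun _ _ hm =>
      Fin.ext (Nat.add_right_cancel hm)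
  have hcard := linearIndependent_le_span' φ hli W hspan
  simp only [Cardinal.mk_fin, Finset.coe_sort_coe, Fintype.card_coe] at hcard
  have : 3 ≤ W.card := by exact_mod_cast hcard
  exact absurd (this.trans Finset.card_le_two) (by norm_num)

theorem theorem5p1 (s : ℕ) (hs : s ≤ 6) :
    (¬ ∃ m : ExpRK.Method, m.ConvergentOfOrder s 5) ∧
      (¬ ∃ m : ExpRK.Method, m.StiffOrderFour s) :=
  ⟨fun ⟨_, hm⟩ => theorem5p1_general s hs ⟨_, _, _, hm.scalarConditions⟩,
    fun ⟨_, hm⟩ => theorem5p1_general s hs ⟨_, _, _, hm.scalarConditions⟩⟩
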